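/- \textbf{Setting.} There are $n$ experts and independent real signals $X_T$, $T\subseteq[n]$, with $\mathbb E[X_T]=0$, $\mathrm{Var}(X_T)<\infty$, $X_\emptyset=0$ and $\mathrm{Var}(X_T)>0$ for at least one $T$; the joint law is the prior $\mathcal D=(\mathcal D_T)_T$. Expert $i$ observes $\mathcal S_i=(X_T)_{T\ni i}$ and knows $\mathcal D$, and $Y=\sum_T X_T$. A query $Q$ is put to an expert $i=\mathrm{agent}(Q)$ and is a real function of $(\mathcal S_i,\mathcal D)$. It is elicitable with respect to a family $R$ of random variables if for some payment function $\pi(r,R)$ its answer is, for every $\mathcal D$, almost surely the unique maximizer over $r\in\mathbb R$ of $\mathbb E[\pi(r,R)\mid\mathcal S_i]$. A finite list $\mathcal Q$ of queries is DAG-elicited by a directed acyclic graph $G$ on $\mathcal Q\cup\{Y\}$ if $Y$ is the unique sink of $G$ and each $Q\in\mathcal Q$ is elicitable with respect to its set $N_G(Q)$ of out-neighbours. The order complexity of $\mathcal Q$ is the minimum, over all $G$ that DAG-elicit $\mathcal Q$, of the maximal length of a directed path in $G$ from a query to $Y$; its agent complexity is the minimum over such $G$ of $\max_{Q}|\{\mathrm{agent}(Q'):Q'\in\mathcal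 Q \text{ reachable from } Q \text{ in } G\}|$ (each $Q$ is reachable from itself). A linear aggregation rule is a pair $(\mathcal Q,f)$ such that, for some $G$ that DAG-elicits $\mathcal Q$ and some real constants $\alpha_{Q,Q'},\beta_Q$ (independent of $\mathcal D$), each $Q\in\mathcal Q$ equals $\mathbb E\big[\sum_{Q'\in N_G(Q)}\alpha_{Q,Q'}Q'\mid\mathcal S_{\mathrm{agent}(Q)}\big]$ and $f(\mathcal Q)=\sum_{Q}\beta_Q Q$. A randomized linear aggregation rule draws a linear aggregation rule at random, independently of the signals; it implements the approximator $A=f(\mathcal Q)$. Let $\mathcal A_d^{\mathrm{lin}}$ be the set of approximators implemented by randomized linear aggregation rules almost all of whose query lists have agent complexity at most $d$ and order complexity at most $d$. Put $$\mathrm{error}(A)=\sup_{\mathcal D}\frac{\mathbb E[(A-Y)^2]}{\sum_T\mathrm{Var}(X_T)},\qquad E(n,d)=\inf_{A\in\mathcal A_d^{\mathrm{lin}}}\mathrm{error}(A).$$ \textbf{Theorem.} The infimum $E(n,d)$ is finite and attained for all $n,d$. For every sequence $d=d(n)$ of natural numbers, as $n\to\infty$: \begin{itemize} \item if $d=o(\sqrt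 n)$, then $E(n,d)=1-\Theta(d^2/n)$; \item if $d=\Theta(\sqrt n)$, then $E(n,d)$ is bounded away from $0$ and $1$: there are constants $0<a\le b<1$ with $a\le E(n,d)\le b$ for all large $n$; and if moreover $d/\sqrt n$ converges to some $c\in(0,\infty)$, then $\lim_{n\to\infty}E(n,d)$ exists and lies in $(0,1)$; \item if $d=\omega(\sqrt n)$, then $E(n,d)=O\big(e^{-4d/\sqrt n}\big)$. \end{itemize} -/

import Mathlib

open MeasureTheory ProbabilityTheory Filter Asymptotics
open scoped Topology ENNReal

/-! ### The partial information model -/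

/-- A prior of the partial information model with `n` experts: independent signals `X_T`, one for
each set `T` of experts, where `X_T` has law `dist T`, mean zero and finite variance; `X_∅ = 0`, and
some signal has positive variance. -/
structure Prior (n : ℕ) where
  dist : Finset (Fin n) → Measure ℝ
  isProb : ∀ T, IsProbabilityMeasure (dist T)
  memLp_two : ∀ T, MemLp (fun x : ℝ => x) 2 (dist T)
  mean_zero : ∀ T, ∫ x, x ∂(dist T) = 0
  dist_empty : dist ∅ = Measure.dirac 0
  exists_var_pos : ∃ T, 0 < variance (fun x : ℝ => x) (dist T)

/-- A realization of all the signals `X_T`; the random variable `X_T` is the coordinate `T`. -/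
abbrev Signals (n : ℕ) : Type := Finset (Fin n) → ℝ

/-- The joint law of the independent signals `(X_T)_T`. -/
noncomputable def Prior.law {n : ℕ} (D : Prior n) : Measure (Signals n) := Measure.pi D.dist

instance Prior.instIsProbDist {n : ℕ} (D : Prior n) (T : Finset (Fin n)) :
    IsProbabilityMeasure (D.dist T) := D.isProb T

instance Prior.instIsProbLaw {n : ℕ} (D : Prior n) : IsProbabilityMeasure D.law := by
  unfold Prior.law; infer_instance

/-- The quantity of interest, `Y = ∑_T X_T`. -/
noncomputable def target {n : ℕ} (x : Signals n) : ℝ := ∑ T, x T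

/-- What expert `i` observes: the signals `X_T` with `i ∈ T`. -/
abbrev AgentSignals {n : ℕ} (i : Fin n) : Type := {T : Finset (Fin n) // i ∈ T} → ℝ

/-- The observation `S_i` of expert `i`. -/
def observe {n : ℕ} (i : Fin n) (x : Signals n) : AgentSignals i := fun T => x T.1

/-- The sigma-algebra generated by the observation of expert `i`. -/
abbrev agentSigma {n : ℕ} (i : Fin n) : MeasurableSpace (Signals n) :=
  MeasurableSpace.comap (observe i) inferInstance

/-! ### Queries, elicitability and DAG-elicitable query lists -/

/-- A query: it is put to an expert, and maps the information of that expert and the prior to a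
real number. -/
structure Query (n : ℕ) where
  agent : Fin n
  answer : Prior n → AgentSignals agent → ℝ
  measurable_answer : ∀ D, Measurable (answer D)

/-- The output of a query as a random variable. -/
def Query.out {n : ℕ} (Q : Query n) (D : Prior n) (x : Signals n) : ℝ :=
  Q.answer D (observe Q.agent x)

/-- `Q` is elicitable with respect to a countable family `R` of random variables: for some payment
`π (r, R)`, the truthful answer is almost surely the unique maximizer over all reports `r` of the
expected payment conditional on the information of the expert. -/
def Elicitable {n : ℕ} {κ : Type} [Countable κ] (Q : Query n)
    (R : κ → Prior n → Signals n → ℝ) : Prop :=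
  ∃ π : ℝ → (κ → ℝ) → ℝ, ∀ D : Prior n, ∀ᵐ x ∂D.law,
    let ν : Measure (κ → ℝ) :=
      condDistrib (fun y v => R v D y) (observe Q.agent) D.law (observe Q.agent x)
    (∀ r : ℝ, Integrable (π r) ν) ∧
      ∀ r : ℝ, r ≠ Q.out D x → ∫ z, π r z ∂ν < ∫ z, π (Q.out D x) z ∂ν

/-- The random variable at a node of a graph on the node set `𝒬 ∪ {Y}`: `some j` is the `j`-th
query of the list and `none` is `Y`. -/
noncomputable def nodeVar {n m : ℕ} (𝒬 : Fin m → Query n) :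
    Option (Fin m) → Prior n → Signals n → ℝ
  | some j => (𝒬 j).out
  | none => fun _ => target

/-- The directed graph `G` on `𝒬 ∪ {Y}` DAG-elicits the list `𝒬`: it is acyclic, `Y` is its unique
sink, and each query is elicitable with respect to its out-neighbours. -/
def DAGElicits {n m : ℕ} (𝒬 : Fin m → Query n) (G : Digraph (Option (Fin m))) : Prop :=
  (∀ v, ¬ Relation.TransGen G.Adj v v) ∧
  (∀ v, (∀ w, ¬ G.Adj v w) ↔ v = none) ∧
  ∀ j : Fin m, Elicitable (𝒬 j)
    (fun v : {v : Option (Fin m) // G.Adj (some j) v} => nodeVar 𝒬 v.1)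

/-! ### Order complexity and agent complexity -/

/-- The order of the `j`-th query under `G`: the maximal length of a directed path to `Y`. (In an
acyclic graph each directed walk is a path.) -/
noncomputable def orderIn {m : ℕ} (G : Digraph (Option (Fin m))) (j : Fin m) : ℕ∞ :=
  sSup {k : ℕ∞ | ∃ (l : ℕ) (w : ℕ → Option (Fin m)), k = (l : ℕ∞) ∧ w 0 = some j ∧ w l = none ∧
    ∀ i < l, G.Adj (w i) (w (i + 1))}

/-- The experts whose beliefs are relevant to the `j`-th query under `G`: those asked some query
that is reachable from it (itself included). -/
def relevantAgents {n m : ℕ} (𝒬 : Fin m → Query n) (G : Digraph (Option (Fin m))) (j : Fin m) :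
    Set (Fin n) :=
  {i | ∃ k : Fin m, Relation.ReflTransGen G.Adj (some j) (some k) ∧ (𝒬 k).agent = i}

/-- Order complexity of a query list (`⊤` if it is not DAG-elicitable). -/
noncomputable def orderComplexity {n m : ℕ} (𝒬 : Fin m → Query n) : ℕ∞ :=
  ⨅ (G : Digraph (Option (Fin m))) (_ : DAGElicits 𝒬 G), ⨆ j : Fin m, orderIn G j

/-- Agent complexity of a query list (`⊤` if it is not DAG-elicitable). -/
noncomputable def agentComplexity {n m : ℕ} (𝒬 : Fin m → Query n) : ℕ∞ :=
  ⨅ (G : Digraph (Option (Fin m))) (_ : DAGElicits 𝒬 G),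
    ⨆ j : Fin m, (relevantAgents 𝒬 G j).encard

/-! ### Aggregation rules -/

/-- A deterministic aggregation rule: a finite list of queries and an aggregation function. -/
structure AggregationRule (n : ℕ) where
  size : ℕ
  query : Fin size → Query n
  aggregate : (Fin size → ℝ) → ℝ

/-- The output `f(𝒬)` of a deterministic aggregation rule. -/
def AggregationRule.output {n : ℕ} (R : AggregationRule n) (D : Prior n) (x : Signals n) : ℝ :=
  R.aggregate (fun j => (R.query j).out D x)

open Classical in
/-- A linear aggregation rule: for some graph that DAG-elicits the query list, each query is the
conditional expectation, given the information of the expert asked, of a linear combination of its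
out-neighbours, with coefficients that do not depend on the prior; and the aggregation function is
linear. -/
def AggregationRule.IsLinear {n : ℕ} (R : AggregationRule n) : Prop :=
  (∃ G : Digraph (Option (Fin R.size)), DAGElicits R.query G ∧
    ∃ α : Fin R.size → Option (Fin R.size) → ℝ, ∀ (j : Fin R.size) (D : Prior n),
      (R.query j).out D =ᵐ[D.law]
        (D.law)[fun x => ∑ v with G.Adj (some j) v, α j v * nodeVar R.query v D x |
          agentSigma (R.query j).agent]) ∧
  ∃ β : Fin R.size → ℝ, ∀ y, R.aggregate y = ∑ j, β j * y j

/-- A random context: a probability space, independent of the signals, from which the principal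
draws the aggregation rule. -/
structure RandomContext where
  Ω : Type
  [instMeasurableSpace : MeasurableSpace Ω]
  P : Measure Ω
  [instIsProb : IsProbabilityMeasure P]

attribute [instance] RandomContext.instMeasurableSpace RandomContext.instIsProb

/-- A randomized aggregation rule over a random context. -/
structure RandomizedRule (n : ℕ) (Z : RandomContext) where
  rule : Z.Ω → AggregationRule n
  measurable_output : ∀ D : Prior n,
    Measurable (fun p : Z.Ω × Signals n => (rule p.1).output D p.2)

/-- An approximator of `Y`, as a random variable on the context and the signals for each prior. -/
abbrev Approximator (n : ℕ) (Z : RandomContext) : Type := Prior n → Z.Ω × Signals n → ℝ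

/-- `A` is implemented by a randomized rule: it is almost surely its output, for each prior. -/
def RandomizedRule.Implements {n : ℕ} {Z : RandomContext} (R : RandomizedRule n Z)
    (A : Approximator n Z) : Prop :=
  ∀ D : Prior n, ∀ᵐ p ∂(Z.P.prod D.law), A D p = (R.rule p.1).output D p.2

/-- The approximators that are implemented by a randomized linear aggregation rule of agent and
order complexity at most `d`. -/
def linApproximators (n d : ℕ) (Z : RandomContext) : Set (Approximator n Z) :=
  {A | ∃ R : RandomizedRule n Z, R.Implements A ∧
    ∀ᵐ z ∂Z.P, (R.rule z).IsLinear ∧ agentComplexity (R.rule z).query ≤ d ∧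
      orderComplexity (R.rule z).query ≤ d}

/-! ### Error -/

/-- The expected squared error of an approximator under the prior `D`. -/
noncomputable def loss {n : ℕ} {Z : RandomContext} (A : Approximator n Z) (D : Prior n) : ℝ≥0∞ :=
  ∫⁻ p, ENNReal.ofReal ((A D p - target p.2) ^ 2) ∂(Z.P.prod D.law)

/-- The worst-case error of an approximator: the maximum over all priors of the expected squared
error divided by the variance of `Y`. -/
noncomputable def worstError {n : ℕ} {Z : RandomContext} (A : Approximator n Z) : ℝ≥0∞ :=
  ⨆ D : Prior n, loss A D / ENNReal.ofReal (∑ T, variance (fun x : ℝ => x) (D.dist T))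

/-- The best worst-case error of the approximators that are implemented by randomized linear
aggregation rules of agent and order complexity at most `d`. -/
noncomputable def optimalError (n d : ℕ) : ℝ≥0∞ :=
  ⨅ (Z : RandomContext) (A : Approximator n Z) (_ : A ∈ linApproximators n d Z), worstError A

/-!
The optimal error is the square of `minDev n d`, the least uniform norm on `{1, …, n}` of a
polynomial `p` of degree at most `d` with `p 0 = 1`. For a two-point prior `X_T = ± v T`,
elicitability forces the coefficients of a query, as functions of the signal index `T`, to be
combinations of those of its out-neighbours on the sets `T` that contain its agent. Hence a linear
rule outputs a linear form whose coefficient at `T` is a polynomial of degree at most `d` in the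
membership indicators of `T`, with no constant term. A prior whose variances are the weights of an
optimal dual solution, spread over the sets of each size, bounds the error from below. Conversely,
nested forecasts of `Y` realize every coefficient function `q |T|` with `q 0 = 0` and `deg q ≤ d`,
and `1 - q` can be taken to be extremal.

Chebyshev polynomials bound `minDev` from above, and a Bernstein–Walsh estimate in the style of
Coppersmith and Rivlin bounds it from below. If `d / √n` converges, an extremal polynomial for `n`
composed with a rescaled Chebyshev polynomial is nearly extremal for all large `m`, so `minDev`
converges.
-/

/-! ### Growth of polynomials that are bounded on an interval -/

section BernsteinWalsh

open Polynomial

/-- The Joukowski map for the interval `[a, b]`: it maps the unit circle onto `[a, b]`, and the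
other circles with centre `0` onto the ellipses with foci `a` and `b`. -/
noncomputable def joukowski (a b : ℝ) (w : ℂ) : ℂ := (a + b) / 2 + (b - a) / 4 * (w + w⁻¹)

lemma joukowski_of_norm_eq_one (a b : ℝ) {w : ℂ} (hw : ‖w‖ = 1) :
    joukowski a b w = (((a + b) / 2 + (b - a) / 2 * w.re : ℝ) : ℂ) := by
  rw [joukowski, Complex.inv_def, Complex.normSq_eq_norm_sq, hw]
  apply Complex.ext <;> simp
  ring

lemma norm_joukowski_sub_add {a b : ℝ} (hab : a ≤ b) {w : ℂ} (hw : w ≠ 0) :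
    ‖joukowski a b w - a‖ + ‖b - joukowski a b w‖ = (b - a) * ((‖w‖ + ‖w‖⁻¹) / 2) := by
  have hleft : joukowski a b w - a = ((b - a : ℝ) : ℂ) / 4 * (w + 1) ^ 2 / w := by
    rw [joukowski]; push_cast; field_simp; ring
  have hright : b - joukowski a b w = -(((b - a : ℝ) : ℂ) / 4 * (w - 1) ^ 2 / w) := by
    rw [joukowski]; push_cast; field_simp; ring
  have hpar : ‖w + 1‖ ^ 2 + ‖w - 1‖ ^ 2 = 2 * (‖w‖ ^ 2 + 1) := by
    have := parallelogram_law_with_norm ℝ w 1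
    rw [norm_one] at this
    linarith
  have hw' : ‖w‖ ≠ 0 := norm_ne_zero_iff.mpr hw
  simp only [hleft, hright, norm_neg, norm_div, norm_mul, norm_pow, Complex.norm_real,
    Real.norm_of_nonneg (sub_nonneg.mpr hab), Complex.norm_ofNat]
  rw [← add_div, ← mul_add, hpar]
  field_simp
  ring

lemma exists_joukowski_eq {a b : ℝ} (hab : a ≠ b) (z : ℂ) :
    ∃ w : ℂ, w ≠ 0 ∧ ‖w‖ ≤ 1 ∧ joukowski a b w = z := by
  have hab' : (b - a : ℂ) ≠ 0 := sub_ne_zero.mpr (by exact_mod_cast hab.symm)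
  set c : ℂ := 4 * (z - (a + b) / 2) / (b - a) with hc
  have key : ∀ {u v : ℂ}, u * v = 1 → u + v = c → joukowski a b u = z := fun {u v} huv hsum => by
    rw [joukowski, inv_eq_of_mul_eq_one_right huv, hsum, hc]
    field_simp
    ring
  obtain ⟨s, hs⟩ := IsAlgClosed.exists_pow_nat_eq (c ^ 2 - 4) (n := 2) two_pos
  have hprod : (c + s) / 2 * ((c - s) / 2) = 1 := by
    linear_combination (-1 / 4 : ℂ) * hs
  rcases le_total ‖(c + s) / 2‖ 1 with h | h
  · exact ⟨_, left_ne_zero_of_mul_eq_one hprod, h, key hprod (by ring)⟩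
  · refine ⟨_, right_ne_zero_of_mul_eq_one hprod, ?_, key ((mul_comm _ _).trans hprod) (by ring)⟩
    rw [← inv_eq_of_mul_eq_one_right hprod, norm_inv]
    exact inv_le_one_of_one_le₀ h

/-- The function `w ^ d * P (joukowski a b w)`, written without its removable singularity at `0`;
`d` stands for a bound of the degree of `P`. -/
noncomputable def joukowskiPullback (P : ℂ[X]) (d : ℕ) (a b : ℝ) (w : ℂ) : ℂ :=
  ∑ i ∈ Finset.range (d + 1),
    P.coeff i * w ^ (d - i) * ((a + b) / 2 * w + (b - a) / 4 * (w ^ 2 + 1)) ^ i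

lemma joukowskiPullback_eq {P : ℂ[X]} {d : ℕ} (hd : P.natDegree ≤ d) (a b : ℝ) {w : ℂ}
    (hw : w ≠ 0) : joukowskiPullback P d a b w = w ^ d * P.eval (joukowski a b w) := by
  rw [joukowskiPullback, eval_eq_sum_range' (Nat.lt_succ_of_le hd), Finset.mul_sum]
  refine Finset.sum_congr rfl fun i hi => ?_
  have hi' : i ≤ d := Nat.lt_succ_iff.mp (Finset.mem_range.mp hi)
  have hJ : (a + b) / 2 * w + (b - a) / 4 * (w ^ 2 + 1) = w * joukowski a b w := by
    rw [joukowski]; field_simp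
  rw [hJ, mul_pow, ← pow_sub_mul_pow w hi']
  ring

lemma norm_joukowskiPullback_le {P : ℂ[X]} {d : ℕ} (hd : P.natDegree ≤ d) {a b S : ℝ}
    (hab : a ≤ b) (hS : ∀ x ∈ Set.Icc a b, ‖P.eval (x : ℂ)‖ ≤ S) {w : ℂ} (hw : ‖w‖ ≤ 1) :
    ‖joukowskiPullback P d a b w‖ ≤ S := by
  have hdiff : Differentiable ℂ (joukowskiPullback P d a b) := by
    unfold joukowskiPullback
    fun_prop
  refine Complex.norm_le_of_forall_mem_frontier_norm_le (U := Metric.ball 0 1)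
    Metric.isBounded_ball hdiff.diffContOnCl (fun v hv => ?_)
    (by rwa [closure_ball _ one_ne_zero, mem_closedBall_zero_iff])
  rw [frontier_ball _ one_ne_zero, mem_sphere_zero_iff_norm] at hv
  have hre := abs_le.mp (hv ▸ Complex.abs_re_le_norm v)
  rw [joukowskiPullback_eq hd a b (norm_ne_zero_iff.mp (hv ▸ one_ne_zero)), norm_mul, norm_pow, hv,
    one_pow, one_mul, joukowski_of_norm_eq_one a b hv]
  exact hS _ ⟨by nlinarith, by nlinarith⟩

/-- **Bernstein–Walsh inequality**: by `hz`, the point `z` lies in the ellipse with foci `a` and `b`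
that is the image of the circle of radius `exp t` under `joukowski a b`. -/
theorem norm_eval_le_mul_exp {P : ℂ[X]} {d : ℕ} (hd : P.natDegree ≤ d) {a b S t : ℝ} (hab : a < b)
    (hS : ∀ x ∈ Set.Icc a b, ‖P.eval (x : ℂ)‖ ≤ S) (ht : 0 ≤ t) {z : ℂ}
    (hz : ‖z - a‖ + ‖b - z‖ ≤ (b - a) * Real.cosh t) : ‖P.eval z‖ ≤ S * Real.exp (d * t) := by
  obtain ⟨w, hw0, hw1, rfl⟩ := exists_joukowski_eq hab.ne z
  have hr : 0 < ‖w‖ := norm_pos_iff.mpr hw0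
  have hlog : -Real.log ‖w‖ ≤ t := by
    have hcosh : Real.cosh (Real.log ‖w‖) ≤ Real.cosh t := by
      rw [Real.cosh_log hr]
      rw [norm_joukowski_sub_add hab.le hw0] at hz
      exact le_of_mul_le_mul_left hz (sub_pos.mpr hab)
    exact (neg_le_abs _).trans ((Real.cosh_le_cosh.mp hcosh).trans_eq (abs_of_nonneg ht))
  have hpull : ‖w‖ ^ d * ‖P.eval (joukowski a b w)‖ ≤ S := by
    simpa only [joukowskiPullback_eq hd a b hw0, norm_mul, norm_pow] using
      norm_joukowskiPullback_le hd hab.le hS hw1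
  have hexp : 1 ≤ ‖w‖ ^ d * Real.exp (d * t) := by
    rw [← Real.exp_log (pow_pos hr d), Real.log_pow, ← Real.exp_add, ← mul_add]
    exact Real.one_le_exp (mul_nonneg (Nat.cast_nonneg _) (by linarith))
  calc ‖P.eval (joukowski a b w)‖
      ≤ ‖P.eval (joukowski a b w)‖ * (‖w‖ ^ d * Real.exp (d * t)) :=
        le_mul_of_one_le_right (norm_nonneg _) hexp
    _ = ‖w‖ ^ d * ‖P.eval (joukowski a b w)‖ * Real.exp (d * t) := by ring
    _ ≤ S * Real.exp (d * t) := by gcongr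

lemma cosh_eq_one_add_two_mul_sinh_sq (t : ℝ) :
    Real.cosh t = 1 + 2 * Real.sinh (t / 2) ^ 2 := by
  have h := Real.cosh_two_mul (t / 2)
  rw [mul_div_cancel₀ t two_ne_zero, Real.cosh_sq] at h
  linarith

lemma one_add_sq_div_two_le_cosh (t : ℝ) : 1 + t ^ 2 / 2 ≤ Real.cosh t := by
  wlog ht : 0 ≤ t generalizing t
  · simpa using this (-t) (by linarith)
  have hsinh : t / 2 ≤ Real.sinh (t / 2) := Real.self_le_sinh_iff.mpr (by linarith)
  rw [cosh_eq_one_add_two_mul_sinh_sq]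
  nlinarith

lemma norm_eval_le_of_norm_sub_add_norm_sub_le {P : ℂ[X]} {d : ℕ} (hd : P.natDegree ≤ d)
    {a b S ρ : ℝ} (hab : a < b) (hS : ∀ x ∈ Set.Icc a b, ‖P.eval (x : ℂ)‖ ≤ S) (hρ : 0 ≤ ρ)
    {z : ℂ} (hz : ‖z - a‖ + ‖b - z‖ ≤ b - a + 2 * ρ) :
    ‖P.eval z‖ ≤ S * Real.exp (2 * d * √(ρ / (b - a))) := by
  have hba : 0 < b - a := sub_pos.mpr hab
  have hcosh := one_add_sq_div_two_le_cosh (2 * √(ρ / (b - a)))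
  rw [mul_pow, Real.sq_sqrt (by positivity)] at hcosh
  have h := norm_eval_le_mul_exp hd hab hS (t := 2 * √(ρ / (b - a))) (by positivity) (z := z) <|
    calc ‖z - a‖ + ‖b - z‖ ≤ (b - a) * (1 + 2 ^ 2 * (ρ / (b - a)) / 2) :=
          hz.trans_eq (by field_simp)
      _ ≤ _ := by gcongr
  rwa [← mul_assoc, mul_comm (d : ℝ) 2] at h

lemma norm_eval_le_of_norm_sub_le {P : ℂ[X]} {d : ℕ} (hd : P.natDegree ≤ d) {a b S ρ : ℝ}
    (hab : a < b) (hS : ∀ x ∈ Set.Icc a b, ‖P.eval (x : ℂ)‖ ≤ S) {x : ℝ} (hx : x ∈ Set.Icc a b)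
    {z : ℂ} (hz : ‖z - x‖ ≤ ρ) : ‖P.eval z‖ ≤ S * Real.exp (2 * d * √(ρ / (b - a))) := by
  refine norm_eval_le_of_norm_sub_add_norm_sub_le hd hab hS ((norm_nonneg _).trans hz) ?_
  have hleft : ‖z - a‖ ≤ ‖z - x‖ + (x - a) := by
    have h := norm_sub_le_norm_sub_add_norm_sub z (x : ℂ) (a : ℂ)
    rwa [← Complex.ofReal_sub, Complex.norm_real, Real.norm_of_nonneg (sub_nonneg.mpr hx.1)] at h
  have hright : ‖b - z‖ ≤ (b - x) + ‖z - x‖ := by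
    have h := norm_sub_le_norm_sub_add_norm_sub (b : ℂ) (x : ℂ) z
    rwa [← Complex.ofReal_sub, Complex.norm_real, Real.norm_of_nonneg (sub_nonneg.mpr hx.2),
      norm_sub_rev (x : ℂ) z] at h
  linarith

lemma norm_eval_derivative_le_of_sphere {P : ℂ[X]} {c : ℂ} {ρ B : ℝ} (hρ : 0 < ρ)
    (h : ∀ z, ‖z - c‖ = ρ → ‖P.eval z‖ ≤ B) : ‖P.derivative.eval c‖ ≤ B / ρ := by
  rw [← Polynomial.deriv]
  exact Complex.norm_deriv_le_of_forall_mem_sphere_norm_le hρ P.differentiable.diffContOnCl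
    fun z hz => h z (mem_sphere_iff_norm.mp hz)

/-- A Markov type inequality: the choice `ρ = (b - a) / d ^ 2` gives the order `d ^ 2`. -/
lemma norm_eval_derivative_le {P : ℂ[X]} {d : ℕ} (hd : P.natDegree ≤ d) {a b S ρ : ℝ}
    (hab : a < b) (hS : ∀ x ∈ Set.Icc a b, ‖P.eval (x : ℂ)‖ ≤ S) (hρ : 0 < ρ)
    {x : ℝ} (hx : x ∈ Set.Icc a b) :
    ‖P.derivative.eval (x : ℂ)‖ ≤ S * Real.exp (2 * d * √(ρ / (b - a))) / ρ :=
  norm_eval_derivative_le_of_sphere hρ fun _ hz => norm_eval_le_of_norm_sub_le hd hab hS hx hz.le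

lemma norm_ofReal_add_le_add_re_add_one {K x : ℝ} (hK : 4 ≤ K) (hx : K ≤ x) {u : ℂ}
    (hu : ‖u‖ = √K) : ‖(x : ℂ) + u‖ ≤ x + u.re + 1 := by
  have hsqrt : √K ≤ K / 2 := Real.sqrt_le_iff.mpr ⟨by linarith, by nlinarith⟩
  have hre : -√K ≤ u.re := (abs_le.mp (hu ▸ Complex.abs_re_le_norm u)).1
  have hnorm : u.re ^ 2 + u.im ^ 2 = K := by
    rw [← Real.sq_sqrt (by linarith : 0 ≤ K), ← hu, ← Complex.normSq_eq_norm_sq,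
      Complex.normSq_apply]
    ring
  refine abs_le_of_sq_le_sq' ?_ (by linarith) |>.2
  rw [← Complex.normSq_eq_norm_sq, Complex.normSq_apply]
  simp only [Complex.add_re, Complex.add_im, Complex.ofReal_re, Complex.ofReal_im]
  nlinarith

/-- A Bernstein type inequality: away from the end points, the circle of radius `√K` about `x` lies
in an ellipse whose axis exceeds `b - a` by `2` only. -/
lemma norm_eval_derivative_le_div_sqrt {P : ℂ[X]} {d : ℕ} (hd : P.natDegree ≤ d) {a b S K : ℝ}
    (hS : ∀ x ∈ Set.Icc a b, ‖P.eval (x : ℂ)‖ ≤ S) (hK : 4 ≤ K)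
    {x : ℝ} (hx : x ∈ Set.Icc (a + K) (b - K)) :
    ‖P.derivative.eval (x : ℂ)‖ ≤ S * Real.exp (2 * d * √(1 / (b - a))) / √K := by
  refine norm_eval_derivative_le_of_sphere (Real.sqrt_pos.mpr (by linarith)) fun z hz => ?_
  refine norm_eval_le_of_norm_sub_add_norm_sub_le hd (by linarith [hx.1, hx.2]) hS zero_le_one ?_
  have hleft := norm_ofReal_add_le_add_re_add_one hK (x := x - a) (by linarith [hx.1]) hz
  have hright := norm_ofReal_add_le_add_re_add_one hK (x := b - x) (by linarith [hx.2])
    (u := -(z - x)) (by rw [norm_neg, hz])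
  rw [show ((x - a : ℝ) : ℂ) + (z - x) = z - a by push_cast; ring] at hleft
  rw [show ((b - x : ℝ) : ℂ) + -(z - x) = b - z by push_cast; ring, Complex.neg_re] at hright
  linarith

lemma norm_eval_sub_le_of_norm_eval_derivative_le {P : ℂ[X]} {a b L : ℝ}
    (h : ∀ x ∈ Set.Icc a b, ‖P.derivative.eval (x : ℂ)‖ ≤ L) {x y : ℝ} (hx : x ∈ Set.Icc a b)
    (hy : y ∈ Set.Icc a b) : ‖P.eval (x : ℂ) - P.eval (y : ℂ)‖ ≤ L * |x - y| :=
  (convex_Icc a b).norm_image_sub_le_of_norm_hasDerivWithin_le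
    (f := fun t : ℝ => P.eval (t : ℂ)) (f' := fun t : ℝ => P.derivative.eval (t : ℂ))
    (fun t _ => ((P.hasDerivAt (t : ℂ)).comp_ofReal).hasDerivWithinAt) h hy hx

end BernsteinWalsh

/-! ### Polynomials that are bounded at integers -/

section IntegerPoints

open Polynomial

lemma exists_interpolation_bound (s : Finset ℂ) (R : ℝ) :
    ∃ Λ : ℝ, 0 ≤ Λ ∧ ∀ (y : ℂ → ℂ) (B : ℝ), (∀ a ∈ s, ‖y a‖ ≤ B) →
      ∃ I : ℂ[X], (∀ a ∈ s, I.eval a = y a) ∧ ∀ z : ℂ, ‖z‖ ≤ R → ‖I.eval z‖ ≤ Λ * B := by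
  choose c hc using fun a => (isCompact_closedBall (0 : ℂ) R).exists_bound_of_continuousOn
    (Lagrange.basis s id a).continuous.continuousOn
  refine ⟨∑ a ∈ s, |c a|, Finset.sum_nonneg fun a _ => abs_nonneg _, fun y B hy =>
    ⟨Lagrange.interpolate s id y, fun a ha =>
      Lagrange.eval_interpolate_at_node y Function.injective_id.injOn ha, fun z hz => ?_⟩⟩
  rw [Lagrange.interpolate_apply, eval_finsetSum, Finset.sum_mul]
  refine norm_sum_le_of_le s fun a ha => ?_
  rw [eval_mul, eval_C, norm_mul, mul_comm]
  have hbasis := (hc a z (mem_closedBall_zero_iff.mpr hz)).trans (le_abs_self _)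
  have hya := hy a ha
  gcongr

/-- A Schwarz lemma: dividing by the product over the zeros, the maximum principle on the larger
ball applies to the quotient. -/
lemma norm_eval_le_mul_div_pow {E : ℂ[X]} {s : Finset ℂ} {r R T : ℝ} (hrR : r < R)
    (hs : ∀ a ∈ s, ‖a‖ ≤ r) (h0 : ∀ a ∈ s, E.eval a = 0)
    (hT : ∀ z : ℂ, ‖z‖ = R → ‖E.eval z‖ ≤ T) {z : ℂ} (hz : ‖z‖ ≤ r) :
    ‖E.eval z‖ ≤ T * (2 * r / (R - r)) ^ s.card := by
  have hr : 0 ≤ r := (norm_nonneg z).trans hz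
  have hR : R ≠ 0 := by linarith
  have hRr : 0 < R - r := sub_pos.mpr hrR
  obtain ⟨Q, rfl⟩ : ∏ a ∈ s, (X - C a) ∣ E :=
    Finset.prod_dvd_of_coprime
      (fun a _ b _ hab => pairwise_coprime_X_sub_C Function.injective_id hab)
      fun a ha => dvd_iff_isRoot.mpr (h0 a ha)
  have hprod : ∀ v : ℂ, ‖(∏ a ∈ s, (X - C a)).eval v‖ = ∏ a ∈ s, ‖v - a‖ := fun v => by
    simp only [eval_prod, norm_prod, eval_sub, eval_X, eval_C]
  have hsphere : ∀ v ∈ frontier (Metric.ball (0 : ℂ) R), ‖Q.eval v‖ ≤ T / (R - r) ^ s.card := by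
    intro v hv
    rw [frontier_ball _ hR, mem_sphere_zero_iff_norm] at hv
    have hlow : (R - r) ^ s.card ≤ ∏ a ∈ s, ‖v - a‖ := by
      rw [← Finset.prod_const]
      refine Finset.prod_le_prod (fun _ _ => hRr.le) fun a ha => ?_
      linarith [norm_sub_norm_le v a, hs a ha]
    rw [le_div_iff₀' (by positivity)]
    refine (mul_le_mul_of_nonneg_right hlow (norm_nonneg _)).trans ?_
    rw [← hprod, ← norm_mul, ← eval_mul]
    exact hT v hv
  have hQ : ‖Q.eval z‖ ≤ T / (R - r) ^ s.card :=
    Complex.norm_le_of_forall_mem_frontier_norm_le Metric.isBounded_ball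
      (f := fun v => Q.eval v) Q.differentiable.diffContOnCl hsphere
      (by rw [closure_ball _ hR, mem_closedBall_zero_iff]; linarith)
  have hupp : ∏ a ∈ s, ‖z - a‖ ≤ (2 * r) ^ s.card := by
    rw [← Finset.prod_const]
    refine Finset.prod_le_prod (fun _ _ => norm_nonneg _) fun a ha => ?_
    linarith [norm_sub_le z a, hs a ha]
  calc ‖((∏ a ∈ s, (X - C a)) * Q).eval z‖ = (∏ a ∈ s, ‖z - a‖) * ‖Q.eval z‖ := by
        rw [eval_mul, norm_mul, hprod]
    _ ≤ (2 * r) ^ s.card * (T / (R - r) ^ s.card) := by gcongr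
    _ = T * (2 * r / (R - r)) ^ s.card := by rw [div_pow]; ring

lemma exists_norm_eval_le_mul_add (s : Finset ℂ) {r R : ℝ} (hrR : r < R)
    (hs : ∀ a ∈ s, ‖a‖ ≤ r) : ∃ Λ : ℝ, ∀ (P : ℂ[X]) (B T : ℝ),
      (∀ a ∈ s, ‖P.eval a‖ ≤ B) → (∀ z : ℂ, ‖z‖ = R → ‖P.eval z‖ ≤ T) →
      ∀ z : ℂ, ‖z‖ ≤ r → ‖P.eval z‖ ≤ Λ * B + T * (2 * r / (R - r)) ^ s.card := by
  obtain ⟨Λ, _, h⟩ := exists_interpolation_bound s R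
  refine ⟨Λ * (1 + (2 * r / (R - r)) ^ s.card), fun P B T hB hT z hz => ?_⟩
  obtain ⟨I, hI, hIR⟩ := h (fun a => P.eval a) B hB
  have herr : ‖(P - I).eval z‖ ≤ (T + Λ * B) * (2 * r / (R - r)) ^ s.card := by
    refine norm_eval_le_mul_div_pow hrR hs (fun a ha => by rw [eval_sub, hI a ha, sub_self])
      (fun v hv => ?_) hz
    rw [eval_sub]
    exact (norm_sub_le _ _).trans (add_le_add (hT v hv) (hIR v hv.le))
  calc ‖P.eval z‖ = ‖I.eval z + (P - I).eval z‖ := by rw [eval_sub, add_sub_cancel]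
    _ ≤ Λ * B + (T + Λ * B) * (2 * r / (R - r)) ^ s.card :=
        (norm_add_le _ _).trans (add_le_add (hIR z (hz.trans hrR.le)) herr)
    _ = _ := by ring

lemma mul_sqrt_div_le_of_le_mul_sqrt {C d n ρ : ℝ} (hn : 0 < n) (hd : d ≤ C * √n) :
    d * √(ρ / n) ≤ C * √ρ := by
  have : 0 < √n := Real.sqrt_pos.mpr hn
  rw [Real.sqrt_div' _ hn.le]
  calc d * (√ρ / √n) ≤ C * √n * (√ρ / √n) := by gcongr
    _ = C * √ρ := by field_simp

lemma exists_nat_mem_Icc_abs_sub_le {a b : ℕ} {x : ℝ} (hx : x ∈ Set.Icc (a : ℝ) b) :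
    ∃ k ∈ Set.Icc a b, |x - k| ≤ 1 / 2 := by
  have hx0 : 0 ≤ x + 1 / 2 := by linarith [hx.1, Nat.cast_nonneg (α := ℝ) a]
  have hfloor := Nat.floor_le hx0
  have hfloor' := Nat.lt_floor_add_one (x + 1 / 2)
  refine ⟨⌊x + 1 / 2⌋₊, ⟨Nat.le_floor (by linarith [hx.1]), Nat.lt_succ_iff.mp ?_⟩,
    abs_le.mpr ⟨by linarith, by linarith⟩⟩
  rw [Nat.floor_lt hx0]
  push_cast
  linarith [hx.2]

/-- `N` is a distance from the end points of `[0, n]` beyond which the Bernstein inequality is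
strong enough, and within which interpolation at `N` points is. -/
lemma exists_edge_width (C : ℝ) : ∃ N : ℕ, 4 ≤ N ∧ 2 * Real.exp (2 * C) ≤ √N ∧
    Real.exp (6 * C * √N) ≤ 4 ^ N / 4 := by
  obtain ⟨N, hN⟩ := exists_nat_ge (max 4 (max ((2 * Real.exp (2 * C)) ^ 2) ((12 * C) ^ 2)))
  simp only [max_le_iff] at hN
  obtain ⟨h4, hexp, hC⟩ := hN
  have hlin : 6 * C * √N ≤ ((N - 1 : ℕ) : ℝ) * 1 := by
    rw [Nat.cast_sub (by exact_mod_cast (by linarith : (1 : ℝ) ≤ N)), Nat.cast_one]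
    have hsq : √(N : ℝ) * √N = N := Real.mul_self_sqrt (by positivity)
    nlinarith [Real.le_sqrt_of_sq_le hC, Real.sqrt_nonneg (N : ℝ)]
  have he : Real.exp 1 ≤ 4 := by linarith [Real.exp_one_lt_d9]
  have hN : 4 ≤ N := by exact_mod_cast h4
  refine ⟨N, hN, Real.le_sqrt_of_sq_le hexp, ?_⟩
  calc Real.exp (6 * C * √N) ≤ Real.exp (((N - 1 : ℕ) : ℝ) * 1) := Real.exp_le_exp.mpr hlin
    _ = Real.exp 1 ^ (N - 1) := Real.exp_nat_mul _ _
    _ ≤ 4 ^ (N - 1) := by gcongr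
    _ = 4 ^ N / 4 := by rw [pow_sub₀ _ four_ne_zero (by omega), pow_one, div_eq_mul_inv]

lemma exists_norm_eval_le_of_mem_Icc_left {C : ℝ} {N : ℕ} (hN : 0 < N)
    (hexp : Real.exp (6 * C * √N) ≤ 4 ^ N / 4) : ∃ Λ : ℝ, ∀ (n : ℝ) (P : ℂ[X]) (B S : ℝ), 0 < n →
      P.natDegree ≤ C * √n → (∀ x ∈ Set.Icc 0 n, ‖P.eval (x : ℂ)‖ ≤ S) →
      (∀ k < N, ‖P.eval (k : ℂ)‖ ≤ B) →
      ∀ x ∈ Set.Icc (0 : ℝ) N, ‖P.eval (x : ℂ)‖ ≤ Λ * B + S / 4 := by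
  have hN0 : (0 : ℝ) < N := Nat.cast_pos.mpr hN
  obtain ⟨Λ, h⟩ := exists_norm_eval_le_mul_add ((Finset.range N).map (Nat.castEmbedding (R := ℂ)))
    (r := N) (R := 9 * N) (by linarith)
    (by simpa using fun k hk => hk.le)
  refine ⟨Λ, fun n P B S hn hd hS hB x hx => ?_⟩
  have hcircle : ∀ z : ℂ, ‖z‖ = 9 * N → ‖P.eval z‖ ≤ S * (4 ^ N / 4) := fun z hz => by
    have hS0 : 0 ≤ S := (norm_nonneg _).trans (hS 0 ⟨le_rfl, hn.le⟩)
    have hgrowth := norm_eval_le_of_norm_sub_le le_rfl hn hS (x := 0) ⟨le_rfl, hn.le⟩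
      (z := z) (ρ := 9 * N) (by simp [hz])
    have hsqrt : √(9 * N : ℝ) = 3 * √N := by
      rw [Real.sqrt_mul (by norm_num), show (9 : ℝ) = 3 ^ 2 by norm_num,
        Real.sqrt_sq (by norm_num)]
    have hdeg := mul_sqrt_div_le_of_le_mul_sqrt (ρ := 9 * N) hn hd
    rw [sub_zero, mul_assoc] at hgrowth
    refine hgrowth.trans ?_
    gcongr
    exact (Real.exp_le_exp.mpr (by rw [hsqrt] at hdeg; linarith)).trans hexp
  have hratio : (2 * N / (9 * N - N) : ℝ) = 1 / 4 := by field_simp; norm_num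
  have := h P B _ (by simpa using hB) hcircle x
    (by rw [Complex.norm_real, Real.norm_of_nonneg hx.1]; exact hx.2)
  rw [hratio, Finset.card_map, Finset.card_range, one_div_pow] at this
  refine this.trans_eq ?_
  field_simp

lemma exists_norm_eval_le_of_mem_Icc_right {C : ℝ} {N : ℕ} (hN : 0 < N)
    (hexp : Real.exp (6 * C * √N) ≤ 4 ^ N / 4) : ∃ Λ : ℝ, ∀ (n : ℝ) (P : ℂ[X]) (B S : ℝ), 0 < n →
      P.natDegree ≤ C * √n → (∀ x ∈ Set.Icc 0 n, ‖P.eval (x : ℂ)‖ ≤ S) →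
      (∀ k < N, ‖P.eval (n - k : ℂ)‖ ≤ B) →
      ∀ x ∈ Set.Icc (n - N) n, ‖P.eval (x : ℂ)‖ ≤ Λ * B + S / 4 := by
  obtain ⟨Λ, h⟩ := exists_norm_eval_le_of_mem_Icc_left hN hexp
  refine ⟨Λ, fun n P B S hn hd hS hB x hx => ?_⟩
  have hrefl : ∀ z : ℂ, (P.comp (Polynomial.C (n : ℂ) - X)).eval z = P.eval (n - z) :=
    fun z => by simp only [eval_comp, eval_sub, eval_C, eval_X]
  have hdeg : (P.comp (Polynomial.C (n : ℂ) - X)).natDegree ≤ P.natDegree := by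
    rw [natDegree_comp]
    exact mul_le_of_le_one_right' (by compute_degree)
  have hbound := h n (P.comp (Polynomial.C (n : ℂ) - X)) B S hn ((Nat.cast_le.mpr hdeg).trans hd)
    (fun y hy => by
      rw [hrefl, ← Complex.ofReal_sub]
      exact hS _ ⟨sub_nonneg.mpr hy.2, sub_le_self _ hy.1⟩)
    (fun k hk => (congrArg norm (hrefl k)).trans_le (hB k hk))
    (n - x) ⟨sub_nonneg.mpr hx.2, by linarith [hx.1]⟩
  rwa [hrefl, Complex.ofReal_sub, sub_sub_cancel] at hbound

lemma norm_eval_le_of_mem_Icc_middle {C B S : ℝ} {N n : ℕ} (hN : 4 ≤ N)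
    (hexp : 2 * Real.exp (2 * C) ≤ √N) (hn : 2 * N ≤ n) {P : ℂ[X]} (hd : P.natDegree ≤ C * √n)
    (hS : ∀ x ∈ Set.Icc (0 : ℝ) n, ‖P.eval (x : ℂ)‖ ≤ S)
    (hB : ∀ k ≤ n, ‖P.eval (k : ℂ)‖ ≤ B) {x : ℝ} (hx : x ∈ Set.Icc (N : ℝ) (n - N)) :
    ‖P.eval (x : ℂ)‖ ≤ B + S / 4 := by
  have hn0 : (0 : ℝ) < n := by exact_mod_cast (by omega : 0 < n)
  have hS0 : 0 ≤ S := (norm_nonneg _).trans (hS 0 ⟨le_rfl, hn0.le⟩)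
  have hN0 : 0 < √(N : ℝ) := Real.sqrt_pos.mpr (by exact_mod_cast (by omega : 0 < N))
  have hcast : ((n - N : ℕ) : ℝ) = n - N := Nat.cast_sub (by omega)
  have hderiv : ∀ y ∈ Set.Icc (N : ℝ) (n - N), ‖P.derivative.eval (y : ℂ)‖ ≤ S / 2 := by
    intro y hy
    have hdeg := mul_sqrt_div_le_of_le_mul_sqrt (ρ := 1) hn0 hd
    rw [Real.sqrt_one, mul_one] at hdeg
    have h := norm_eval_derivative_le_div_sqrt le_rfl hS (K := N) (by exact_mod_cast hN) (x := y)
      (by rwa [zero_add])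
    rw [sub_zero, mul_assoc] at h
    refine h.trans ((div_le_iff₀ hN0).mpr ?_)
    calc S * Real.exp (2 * (P.natDegree * √(1 / n))) ≤ S * Real.exp (2 * C) := by gcongr
      _ ≤ S / 2 * √N := by nlinarith
  obtain ⟨k, hk, hxk⟩ := exists_nat_mem_Icc_abs_sub_le (a := N) (b := n - N) (x := x)
    (by rwa [hcast])
  have hk' : (k : ℝ) ∈ Set.Icc (N : ℝ) (n - N) :=
    ⟨by exact_mod_cast hk.1, by rw [← hcast]; exact_mod_cast hk.2⟩
  have hkB : ‖P.eval ((k : ℝ) : ℂ)‖ ≤ B := by simpa using hB k (hk.2.trans (Nat.sub_le n N))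
  calc ‖P.eval (x : ℂ)‖ ≤ ‖P.eval (x : ℂ) - P.eval ((k : ℝ) : ℂ)‖ + ‖P.eval ((k : ℝ) : ℂ)‖ := by
        simpa using norm_add_le (P.eval (x : ℂ) - P.eval ((k : ℝ) : ℂ)) (P.eval ((k : ℝ) : ℂ))
    _ ≤ S / 2 * |x - k| + B :=
        add_le_add (norm_eval_sub_le_of_norm_eval_derivative_le hderiv hx hk') hkB
    _ ≤ B + S / 4 := by nlinarith

/-- The Coppersmith–Rivlin theorem for degrees `O(√n)`. The maximum `S` on `[0, n]` is bounded by
`Λ * B + S / 4` wherever it is attained: by interpolation near the end points, and by the Bernstein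
inequality and the bound at the nearest integer elsewhere. -/
theorem exists_norm_eval_le_of_natCast (C : ℝ) : ∃ A > 0, ∀ᶠ n : ℕ in atTop,
    ∀ (P : ℂ[X]) (B : ℝ), P.natDegree ≤ C * √n →
      (∀ k ≤ n, ‖P.eval (k : ℂ)‖ ≤ B) → ∀ x ∈ Set.Icc (0 : ℝ) n, ‖P.eval (x : ℂ)‖ ≤ A * B := by
  obtain ⟨N, hN4, hmid, hedge⟩ := exists_edge_width C
  obtain ⟨Λ, hΛ⟩ := exists_norm_eval_le_of_mem_Icc_left (by omega) hedge
  obtain ⟨Λ', hΛ'⟩ := exists_norm_eval_le_of_mem_Icc_right (by omega) hedge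
  refine ⟨2 * max (max Λ Λ') 1, by positivity, ?_⟩
  filter_upwards [eventually_ge_atTop (2 * N)] with n hn P B hd hB
  have hB0 : 0 ≤ B := (norm_nonneg _).trans (hB 0 (Nat.zero_le _))
  have hn0 : (0 : ℝ) < n := by exact_mod_cast (by omega : 0 < n)
  obtain ⟨s, hs, hmax⟩ := isCompact_Icc.exists_isMaxOn (Set.nonempty_Icc.mpr hn0.le)
    (f := fun x : ℝ => ‖P.eval (x : ℂ)‖)
    ((P.continuous.comp Complex.continuous_ofReal).norm.continuousOn)
  suffices h : ‖P.eval (s : ℂ)‖ ≤ max (max Λ Λ') 1 * B + ‖P.eval (s : ℂ)‖ / 4 from fun x hx =>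
    (hmax hx).trans (by nlinarith [le_max_right (max Λ Λ') 1])
  rcases le_total s N with hsN | hsN
  · refine (hΛ n P B _ hn0 hd hmax (fun k hk => hB k (by omega)) s ⟨hs.1, hsN⟩).trans ?_
    gcongr
    exact (le_max_left Λ Λ').trans (le_max_left _ 1)
  rcases le_total ((n : ℝ) - N) s with hsn | hsn
  · refine (hΛ' n P B _ hn0 hd hmax (fun k hk => ?_) s ⟨hsn, hs.2⟩).trans ?_
    · rw [Complex.ofReal_natCast, ← Nat.cast_sub (by omega)]
      exact hB _ (Nat.sub_le n k)
    · gcongr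
      exact (le_max_right Λ Λ').trans (le_max_left _ 1)
  · refine (norm_eval_le_of_mem_Icc_middle hN4 hmid hn hd hmax hB ⟨hsN, hsn⟩).trans ?_
    gcongr
    exact le_mul_of_one_le_left hB0 (le_max_right (max Λ Λ') 1)

end IntegerPoints

section RealPolynomials

open Polynomial

lemma norm_eval_map_ofRealHom (p : ℝ[X]) (x : ℝ) :
    ‖(p.map Complex.ofRealHom).eval (x : ℂ)‖ = |p.eval x| := by
  rw [← Complex.ofRealHom_eq_coe, eval_map_apply, Complex.ofRealHom_eq_coe, Complex.norm_real,
    Real.norm_eq_abs]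

lemma abs_eval_le_of_abs_sub_le {p : ℝ[X]} {d : ℕ} (hd : p.natDegree ≤ d) {a b S ρ : ℝ}
    (hab : a < b) (hS : ∀ x ∈ Set.Icc a b, |p.eval x| ≤ S) {x y : ℝ} (hx : x ∈ Set.Icc a b)
    (hy : |y - x| ≤ ρ) : |p.eval y| ≤ S * Real.exp (2 * d * √(ρ / (b - a))) := by
  simp only [← norm_eval_map_ofRealHom] at hS ⊢
  refine norm_eval_le_of_norm_sub_le (by rwa [natDegree_map]) hab hS hx ?_
  rwa [← Complex.ofReal_sub, Complex.norm_real]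

lemma abs_eval_derivative_le {p : ℝ[X]} {d : ℕ} (hd : p.natDegree ≤ d) {a b S ρ : ℝ}
    (hab : a < b) (hS : ∀ x ∈ Set.Icc a b, |p.eval x| ≤ S) (hρ : 0 < ρ) {x : ℝ}
    (hx : x ∈ Set.Icc a b) :
    |p.derivative.eval x| ≤ S * Real.exp (2 * d * √(ρ / (b - a))) / ρ := by
  simp only [← norm_eval_map_ofRealHom, ← derivative_map] at hS ⊢
  exact norm_eval_derivative_le (by rwa [natDegree_map]) hab hS hρ hx

lemma abs_eval_derivative_le_mul_sq {p : ℝ[X]} {d : ℕ} (hd : p.natDegree ≤ d) {a b S : ℝ}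
    (hab : a < b) (hS : ∀ x ∈ Set.Icc a b, |p.eval x| ≤ S) {x : ℝ} (hx : x ∈ Set.Icc a b) :
    |p.derivative.eval x| ≤ S * Real.exp 2 * (d ^ 2 / (b - a)) := by
  rcases Nat.eq_zero_or_pos d with rfl | hd0
  · obtain ⟨c, rfl⟩ := natDegree_eq_zero.mp (Nat.le_zero.mp hd)
    simp
  have hba : 0 < b - a := sub_pos.mpr hab
  have hsqrt : √((b - a) / d ^ 2 / (b - a)) = 1 / d := by
    rw [div_right_comm, div_self hba.ne', Real.sqrt_div zero_le_one, Real.sqrt_one,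
      Real.sqrt_sq (Nat.cast_nonneg d)]
  refine (abs_eval_derivative_le hd hab hS (ρ := (b - a) / d ^ 2) (by positivity) hx).trans_eq ?_
  rw [hsqrt]
  field_simp

lemma abs_eval_derivative_le_div_sqrt {p : ℝ[X]} {d : ℕ} (hd : p.natDegree ≤ d) {a b S K : ℝ}
    (hS : ∀ x ∈ Set.Icc a b, |p.eval x| ≤ S) (hK : 4 ≤ K) {x : ℝ}
    (hx : x ∈ Set.Icc (a + K) (b - K)) :
    |p.derivative.eval x| ≤ S * Real.exp (2 * d * √(1 / (b - a))) / √K := by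
  simp only [← norm_eval_map_ofRealHom, ← derivative_map] at hS ⊢
  exact norm_eval_derivative_le_div_sqrt (by rwa [natDegree_map]) hS hK hx

lemma abs_eval_sub_le_of_abs_eval_derivative_le {p : ℝ[X]} {a b L : ℝ}
    (h : ∀ x ∈ Set.Icc a b, |p.derivative.eval x| ≤ L) {x y : ℝ} (hx : x ∈ Set.Icc a b)
    (hy : y ∈ Set.Icc a b) : |p.eval x - p.eval y| ≤ L * |x - y| :=
  (convex_Icc a b).norm_image_sub_le_of_norm_hasDerivWithin_le
    (fun t _ => (p.hasDerivAt t).hasDerivWithinAt) h hy hx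

lemma exists_abs_eval_le_of_natCast (C : ℝ) : ∃ A > 0, ∀ᶠ n : ℕ in atTop,
    ∀ (p : ℝ[X]) (B : ℝ), p.natDegree ≤ C * √n → (∀ k ≤ n, |p.eval (k : ℝ)| ≤ B) →
      ∀ x ∈ Set.Icc (0 : ℝ) n, |p.eval x| ≤ A * B := by
  obtain ⟨A, hA, h⟩ := exists_norm_eval_le_of_natCast C
  refine ⟨A, hA, h.mono fun n hn p B hd hB => ?_⟩
  simp only [← norm_eval_map_ofRealHom, Complex.ofReal_natCast] at hB ⊢
  exact hn _ B (by rwa [natDegree_map]) hB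

lemma sqrt_natCast_le_two_mul_sqrt_sub_one {n : ℕ} (hn : 2 ≤ n) :
    √(n : ℝ) ≤ 2 * √((n - 1 : ℕ) : ℝ) := by
  have hn' : (2 : ℝ) ≤ n := by exact_mod_cast hn
  rw [Nat.cast_sub (by omega), Nat.cast_one, Real.sqrt_le_left (by positivity), mul_pow,
    Real.sq_sqrt (by linarith)]
  linarith

lemma exists_abs_eval_zero_le (C : ℝ) : ∃ A > 0, ∀ᶠ n : ℕ in atTop, ∀ (p : ℝ[X]) (B : ℝ),
    p.natDegree ≤ C * √n → (∀ k : ℕ, 1 ≤ k → k ≤ n → |p.eval (k : ℝ)| ≤ B) →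
      |p.eval 0| ≤ A * B := by
  obtain ⟨A, hA, h⟩ := exists_abs_eval_le_of_natCast (2 * C)
  refine ⟨A * Real.exp (4 * C), by positivity, ?_⟩
  filter_upwards [(tendsto_sub_atTop_nat 1).eventually h, eventually_ge_atTop 2]
    with n hn hn2 p B hd hB
  set m : ℕ := n - 1
  have hm : (0 : ℝ) < m := by exact_mod_cast (by omega : 0 < m)
  have hB0 : 0 ≤ B := (abs_nonneg _).trans (hB 1 le_rfl (by omega))
  have hC : 0 ≤ C := nonneg_of_mul_nonneg_left ((Nat.cast_nonneg _).trans hd)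
    (Real.sqrt_pos.mpr (by exact_mod_cast (by omega : 0 < n)))
  have heval : ∀ x, (p.comp (X + Polynomial.C 1)).eval x = p.eval (x + 1) := fun x => by simp
  have hdeg : ((p.comp (X + Polynomial.C 1)).natDegree : ℝ) ≤ 2 * C * √m := by
    rw [natDegree_comp, natDegree_X_add_C, mul_one]
    calc (p.natDegree : ℝ) ≤ C * (2 * √m) :=
          hd.trans (by gcongr; exact sqrt_natCast_le_two_mul_sqrt_sub_one hn2)
      _ = 2 * C * √m := by ring
  have hbound := hn _ B hdeg fun k hk => by
    rw [heval]
    exact_mod_cast hB (k + 1) (by omega) (by omega)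
  have hexp : 2 * (p.comp (X + Polynomial.C 1)).natDegree * √(1 / (m - 0)) ≤ 4 * C := by
    have := mul_sqrt_div_le_of_le_mul_sqrt (ρ := 1) hm hdeg
    rw [Real.sqrt_one] at this
    rw [sub_zero]
    linarith
  have hend := abs_eval_le_of_abs_sub_le le_rfl hm hbound (x := 0) (y := -1) (ρ := 1)
    ⟨le_rfl, hm.le⟩ (by simp)
  rw [heval, neg_add_cancel] at hend
  calc |p.eval 0| ≤ _ := hend
    _ ≤ A * B * Real.exp (4 * C) := by gcongr
    _ = A * Real.exp (4 * C) * B := by ring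

end RealPolynomials

/-! ### The discrete Chebyshev problem -/

section MinDev

open Polynomial

/-- Evaluation of polynomials at the points `1, …, n`. -/
noncomputable def evalPoints (n : ℕ) : ℝ[X] →ₗ[ℝ] (Fin n → ℝ) :=
  LinearMap.pi fun k => leval ((k : ℕ) + 1 : ℝ)

/-- The values at `1, …, n` of the polynomials of degree at most `d` that vanish at `0`. -/
noncomputable def devSpace (n d : ℕ) : Submodule ℝ (Fin n → ℝ) :=
  (degreeLE ℝ d ⊓ LinearMap.ker (leval (0 : ℝ))).map (evalPoints n)

/-- The least maximal modulus on `1, …, n` of a polynomial of degree at most `d` with value `1`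
at `0`, as a distance from a subspace: this makes its dual description available. -/
noncomputable def minDev (n d : ℕ) : ℝ := Metric.infDist (1 : Fin n → ℝ) (devSpace n d)

/-- Solutions of the extremal problem that defines `minDev n d`. -/
structure IsExtremal (n d : ℕ) (p : ℝ[X]) : Prop where
  natDegree_le : p.natDegree ≤ d
  eval_zero : p.eval 0 = 1
  abs_eval_le : ∀ k : ℕ, 1 ≤ k → k ≤ n → |p.eval (k : ℝ)| ≤ minDev n d

lemma minDev_nonneg (n d : ℕ) : 0 ≤ minDev n d := Metric.infDist_nonneg

lemma mem_devSpace {n d : ℕ} {v : Fin n → ℝ} : v ∈ devSpace n d ↔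
    ∃ q : ℝ[X], q.natDegree ≤ d ∧ q.eval 0 = 0 ∧ ∀ k : Fin n, v k = q.eval ((k : ℕ) + 1 : ℝ) := by
  simp only [devSpace, Submodule.mem_map, Submodule.mem_inf, mem_degreeLE,
    ← natDegree_le_iff_degree_le, LinearMap.mem_ker, leval_apply, and_assoc]
  refine exists_congr fun q => and_congr_right fun _ => and_congr_right fun _ => ?_
  rw [eq_comm, funext_iff]
  rfl

lemma minDev_le {n d : ℕ} {p : ℝ[X]} (hd : p.natDegree ≤ d) (h0 : p.eval 0 = 1) {B : ℝ}
    (hB : 0 ≤ B) (h : ∀ k : ℕ, 1 ≤ k → k ≤ n → |p.eval (k : ℝ)| ≤ B) : minDev n d ≤ B := by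
  have hmem : (fun k : Fin n => (1 - p).eval ((k : ℕ) + 1 : ℝ)) ∈ devSpace n d :=
    mem_devSpace.mpr ⟨1 - p, (natDegree_sub_le _ _).trans (by simpa using hd), by simp [h0],
      fun _ => rfl⟩
  refine (Metric.infDist_le_dist_of_mem hmem).trans ((dist_pi_le_iff hB).mpr fun k => ?_)
  simpa [Real.dist_eq] using h (k + 1) (by omega) (by omega)

lemma exists_isExtremal (n d : ℕ) : ∃ p, IsExtremal n d p := by
  obtain ⟨v, hv, hdist⟩ := (Submodule.closed_of_finiteDimensional
    (devSpace n d)).exists_infDist_eq_dist ⟨0, (devSpace n d).zero_mem⟩ (1 : Fin n → ℝ)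
  obtain ⟨q, hq, hq0, hqv⟩ := mem_devSpace.mp hv
  refine ⟨1 - q, (natDegree_sub_le _ _).trans (by simpa using hq), by simp [hq0],
    fun k hk1 hkn => ?_⟩
  have hk := dist_le_pi_dist (1 : Fin n → ℝ) v ⟨k - 1, by omega⟩
  rw [hqv, Real.dist_eq] at hk
  rw [minDev, hdist]
  simpa [Nat.cast_sub hk1] using hk

lemma minDev_le_one (n d : ℕ) : minDev n d ≤ 1 :=
  minDev_le (p := 1) (by simp) (by simp) zero_le_one (by simp)

lemma IsExtremal.abs_eval_natCast_le_one {n d : ℕ} {p : ℝ[X]} (hp : IsExtremal n d p) {k : ℕ}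
    (hk : k ≤ n) : |p.eval (k : ℝ)| ≤ 1 := by
  rcases Nat.eq_zero_or_pos k with rfl | hk0
  · simp [hp.eval_zero]
  · exact (hp.abs_eval_le k hk0 hk).trans (minDev_le_one n d)

/-! #### Upper bounds by Chebyshev polynomials -/

lemma mul_sinh_le_sinh_mul (d : ℕ) {x : ℝ} (hx : 0 ≤ x) : d * Real.sinh x ≤ Real.sinh (d * x) := by
  induction d with
  | zero => simp
  | succ d ih =>
    have hcosh := Real.one_le_cosh x
    have hcosh_mul := Real.one_le_cosh (d * x)
    have hsinh := Real.sinh_nonneg_iff.mpr hx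
    have hsinh_mul : 0 ≤ Real.sinh (d * x) := Real.sinh_nonneg_iff.mpr (by positivity)
    rw [Nat.cast_succ, add_mul, one_mul, add_mul, one_mul, Real.sinh_add]
    nlinarith

lemma one_add_sq_mul_le_eval_T (d : ℕ) {u : ℝ} (hu : 1 ≤ u) :
    1 + d ^ 2 * (u - 1) ≤ (Chebyshev.T ℝ d).eval u := by
  obtain ⟨s, hs, rfl⟩ : ∃ s, 0 ≤ s ∧ Real.cosh s = u :=
    ⟨_, Real.arcosh_nonneg hu, Real.cosh_arcosh hu⟩
  rw [Chebyshev.T_real_cosh, Int.cast_natCast, cosh_eq_one_add_two_mul_sinh_sq (d * s),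
    cosh_eq_one_add_two_mul_sinh_sq s, mul_div_assoc]
  have hle := mul_sinh_le_sinh_mul d (x := s / 2) (by positivity)
  have hnonneg : 0 ≤ d * Real.sinh (s / 2) :=
    mul_nonneg (Nat.cast_nonneg _) (Real.sinh_nonneg_iff.mpr (by positivity))
  nlinarith

lemma exp_div_two_le_eval_T (d : ℕ) {s u : ℝ} (hs : 0 ≤ s) (hu : Real.cosh s ≤ u) :
    Real.exp (d * s) / 2 ≤ (Chebyshev.T ℝ d).eval u := by
  have hu1 := (Real.one_le_cosh s).trans hu
  obtain ⟨t, ht, rfl⟩ : ∃ t, 0 ≤ t ∧ Real.cosh t = u :=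
    ⟨_, Real.arcosh_nonneg hu1, Real.cosh_arcosh hu1⟩
  have hst : s ≤ t := by
    rwa [Real.cosh_le_cosh, abs_of_nonneg hs, abs_of_nonneg ht] at hu
  rw [Chebyshev.T_real_cosh, Int.cast_natCast, Real.cosh_eq]
  have hexp : Real.exp (d * s) ≤ Real.exp (d * t) := by gcongr
  linarith [Real.exp_pos (-(d * t))]

lemma natDegree_T_comp_le (d : ℕ) (a b : ℝ) :
    ((Chebyshev.T ℝ d).comp (C a - C b * X)).natDegree ≤ d := by
  rw [natDegree_comp, Chebyshev.natDegree_T, Int.natAbs_natCast]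
  exact mul_le_of_le_one_right' (by compute_degree)

lemma one_le_add_one_div_sub_one {n : ℝ} (hn : 1 < n) : 1 ≤ (n + 1) / (n - 1) := by
  rw [le_div_iff₀ (by linarith)]
  linarith

lemma minDev_le_inv_eval_T {n : ℕ} (hn : 2 ≤ n) (d : ℕ) :
    minDev n d ≤ ((Chebyshev.T ℝ d).eval ((n + 1) / (n - 1) : ℝ))⁻¹ := by
  have hn' : (1 : ℝ) < n := by exact_mod_cast hn
  have hn1 : (0 : ℝ) < n - 1 := by linarith
  set u : ℝ := (n + 1) / (n - 1) with hu
  have hT := Chebyshev.one_le_eval_T_real d (one_le_add_one_div_sub_one hn')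
  have hT0 : (Chebyshev.T ℝ d).eval u ≠ 0 := by positivity
  refine minDev_le (p := C ((Chebyshev.T ℝ d).eval u)⁻¹ *
    (Chebyshev.T ℝ d).comp (C u - C (2 / (n - 1) : ℝ) * X))
    ((natDegree_C_mul_le _ _).trans (natDegree_T_comp_le _ _ _)) (by simp [hT0]) (by positivity)
    fun k hk1 hkn => ?_
  have hk1' : (1 : ℝ) ≤ k := by exact_mod_cast hk1
  have hkn' : (k : ℝ) ≤ n := by exact_mod_cast hkn
  have harg : |u - 2 / (n - 1) * k| ≤ 1 := by
    rw [show u - 2 / (n - 1) * k = (n + 1 - 2 * k) / (n - 1) by rw [hu]; field_simp, abs_le,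
      le_div_iff₀ hn1, div_le_iff₀ hn1]
    constructor <;> linarith
  simp only [eval_mul, eval_C, eval_comp, eval_sub, eval_X, abs_mul]
  rw [abs_of_nonneg (by positivity : 0 ≤ ((Chebyshev.T ℝ d).eval u)⁻¹)]
  exact mul_le_of_le_one_right (by positivity) (Chebyshev.abs_eval_T_real_le_one d harg)

lemma minDev_le_inv {n : ℕ} (hn : 2 ≤ n) (d : ℕ) :
    minDev n d ≤ (1 + 2 * ((d : ℝ) ^ 2 / n))⁻¹ := by
  have hn' : (1 : ℝ) < n := by exact_mod_cast hn
  have hn1 : (0 : ℝ) < n - 1 := by linarith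
  refine (minDev_le_inv_eval_T hn d).trans (inv_anti₀ (by positivity) ?_)
  calc 1 + 2 * ((d : ℝ) ^ 2 / n) = 1 + (d : ℝ) ^ 2 * (2 / n) := by ring
    _ ≤ 1 + (d : ℝ) ^ 2 * (2 / (n - 1)) := by gcongr; linarith
    _ = 1 + (d : ℝ) ^ 2 * ((n + 1) / (n - 1) - 1) := by field_simp; ring
    _ ≤ _ := one_add_sq_mul_le_eval_T d (one_le_add_one_div_sub_one hn')

lemma two_mul_le_log_sub_log {t : ℝ} (h0 : 0 ≤ t) (h1 : t < 1) :
    2 * t ≤ Real.log (1 + t) - Real.log (1 - t) := by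
  have h := Real.hasSum_log_sub_log_of_abs_lt_one (x := t) (by rwa [abs_of_nonneg h0])
  simpa using le_hasSum h 0 fun j _ => by positivity

lemma cosh_two_mul_le {t : ℝ} (h0 : 0 ≤ t) (h1 : t < 1) :
    Real.cosh (2 * t) ≤ (1 + t ^ 2) / (1 - t ^ 2) := by
  have hadd : 0 < 1 + t := by linarith
  have hsub : 0 < 1 - t := by linarith
  have hsq : 1 - t ^ 2 ≠ 0 := by nlinarith
  have hlog : 2 * t ≤ Real.log ((1 + t) / (1 - t)) :=
    (two_mul_le_log_sub_log h0 h1).trans_eq (Real.log_div hadd.ne' hsub.ne').symm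
  calc Real.cosh (2 * t) ≤ Real.cosh (Real.log ((1 + t) / (1 - t))) := by
        rwa [Real.cosh_le_cosh, abs_of_nonneg (by positivity), abs_of_nonneg (by linarith)]
    _ = ((1 + t) / (1 - t) + ((1 + t) / (1 - t))⁻¹) / 2 := Real.cosh_log (by positivity)
    _ = (1 + t ^ 2) / (1 - t ^ 2) := by field_simp; ring

lemma minDev_le_exp {n : ℕ} (hn : 2 ≤ n) (d : ℕ) :
    minDev n d ≤ 2 * Real.exp (-2 * d / √n) := by
  have hn' : (1 : ℝ) < n := by exact_mod_cast hn
  have hsqrt : 1 < √(n : ℝ) := Real.lt_sqrt_of_sq_lt (by linarith)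
  have hcosh := cosh_two_mul_le (t := (√(n : ℝ))⁻¹) (by positivity) (inv_lt_one_of_one_lt₀ hsqrt)
  have hpole : (1 + (√(n : ℝ))⁻¹ ^ 2) / (1 - (√(n : ℝ))⁻¹ ^ 2) = (n + 1) / (n - 1) := by
    have hn1 : (n : ℝ) - 1 ≠ 0 := by linarith
    rw [inv_pow, Real.sq_sqrt (by linarith)]
    field_simp
  have hT := exp_div_two_le_eval_T d (by positivity) (hcosh.trans_eq hpole)
  refine (minDev_le_inv_eval_T hn d).trans ((inv_anti₀ (by positivity) hT).trans_eq ?_)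
  rw [inv_div, div_eq_mul_inv, ← Real.exp_neg]
  congr 2
  ring

/-! #### Lower bounds -/

theorem exists_le_minDev (C : ℝ) : ∃ a > 0, ∀ᶠ n : ℕ in atTop, ∀ d : ℕ,
    d ≤ C * √n → a ≤ minDev n d := by
  obtain ⟨A, hA, h⟩ := exists_abs_eval_zero_le C
  refine ⟨A⁻¹, by positivity, h.mono fun n hn d hd => ?_⟩
  obtain ⟨p, hp⟩ := exists_isExtremal n d
  have hdeg : (p.natDegree : ℝ) ≤ C * √n := (Nat.cast_le.mpr hp.natDegree_le).trans hd
  simpa [hp.eval_zero, inv_le_iff_one_le_mul₀' hA] using hn p _ hdeg hp.abs_eval_le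

theorem exists_one_sub_minDev_le : ∃ c : ℝ, ∀ᶠ n : ℕ in atTop, ∀ d : ℕ,
    d ≤ √n → 1 - minDev n d ≤ c * ((d : ℝ) ^ 2 / n) := by
  obtain ⟨A, -, h⟩ := exists_abs_eval_le_of_natCast 1
  refine ⟨A * Real.exp 2, ?_⟩
  filter_upwards [h, eventually_ge_atTop 1] with n h hn d hd
  obtain ⟨p, hp⟩ := exists_isExtremal n d
  have hn1 : (1 : ℝ) ≤ n := by exact_mod_cast hn
  have hdeg : (p.natDegree : ℝ) ≤ 1 * √n := by
    rw [one_mul]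
    exact (Nat.cast_le.mpr hp.natDegree_le).trans hd
  have hbound : ∀ x ∈ Set.Icc (0 : ℝ) n, |p.eval x| ≤ A := by
    simpa using h p 1 hdeg fun k => hp.abs_eval_natCast_le_one
  have hLip := abs_eval_sub_le_of_abs_eval_derivative_le
    (fun x hx => abs_eval_derivative_le_mul_sq hp.natDegree_le (by linarith) hbound hx)
    (x := 0) (y := 1) ⟨le_rfl, by linarith⟩ ⟨zero_le_one, hn1⟩
  have hone := hp.abs_eval_le 1 le_rfl hn
  rw [Nat.cast_one] at hone
  rw [hp.eval_zero, sub_zero, zero_sub, abs_neg, abs_one, mul_one] at hLip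
  linarith [le_abs_self (1 - p.eval 1), le_abs_self (p.eval 1)]

end MinDev

/-! ### Comparison of the discrete Chebyshev problem at different scales -/

section Comparison

open Polynomial

/-- Extremal polynomials for `minDev n d` that are `L`-Lipschitz on `[0, n]` and exceed `minDev n d`
by at most `ε` between the integers of `[K, n - K]`: those whose composition with a slight
distortion of the identity remains nearly extremal. -/
structure IsRegularExtremal (n d K : ℕ) (L ε : ℝ) (p : ℝ[X]) : Prop extends IsExtremal n d p where
  abs_eval_sub_le : ∀ x ∈ Set.Icc (0 : ℝ) n, ∀ y ∈ Set.Icc (0 : ℝ) n,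
    |p.eval x - p.eval y| ≤ L * |x - y|
  abs_eval_le_add : ∀ x ∈ Set.Icc (K : ℝ) (n - K), |p.eval x| ≤ minDev n d + ε

lemma abs_eval_le_of_abs_eval_natCast_le {p : ℝ[X]} {K n : ℕ} {B ε : ℝ} (hKn : K ≤ n)
    (hB : ∀ k ∈ Set.Icc K (n - K), |p.eval (k : ℝ)| ≤ B)
    (hε : ∀ x ∈ Set.Icc (K : ℝ) (n - K), |p.derivative.eval x| ≤ ε) {x : ℝ}
    (hx : x ∈ Set.Icc (K : ℝ) (n - K)) : |p.eval x| ≤ B + ε := by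
  rw [← Nat.cast_sub hKn] at hε hx
  obtain ⟨k, hk, hxk⟩ := exists_nat_mem_Icc_abs_sub_le hx
  have hLip := abs_eval_sub_le_of_abs_eval_derivative_le hε hx
    (y := k) ⟨by exact_mod_cast hk.1, by exact_mod_cast hk.2⟩
  have hε0 : 0 ≤ ε := (abs_nonneg _).trans (hε x hx)
  have hεk : ε * |x - k| ≤ ε * 1 := by gcongr; linarith
  linarith [hB k hk, abs_sub_abs_le_abs_sub (p.eval x) (p.eval (k : ℝ))]

lemma exists_isRegularExtremal (C : ℝ) {ε : ℝ} (hε : 0 < ε) : ∃ (K : ℕ) (L : ℝ), 0 < K ∧ 0 < L ∧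
    ∀ᶠ n : ℕ in atTop, ∀ d : ℕ, d ≤ C * √n → ∃ p, IsRegularExtremal n d K L ε p := by
  obtain ⟨A, hA, h⟩ := exists_abs_eval_le_of_natCast C
  set L : ℝ := A * Real.exp (2 * C)
  obtain ⟨K, hK⟩ := exists_nat_ge (max 4 ((L / ε) ^ 2))
  have hK4 : (4 : ℝ) ≤ K := (le_max_left _ _).trans hK
  have hK0 : 0 < K := by exact_mod_cast (by linarith : (0 : ℝ) < K)
  have hKL : L ≤ ε * √K := by
    rw [← div_le_iff₀' hε]
    exact Real.le_sqrt_of_sq_le ((le_max_right _ _).trans hK)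
  refine ⟨K, L, hK0, by positivity, ?_⟩
  filter_upwards [h, eventually_ge_atTop K] with n h hn d hd
  obtain ⟨p, hp⟩ := exists_isExtremal n d
  have hn0 : (0 : ℝ) < n := by exact_mod_cast (by omega : 0 < n)
  have hbound : ∀ x ∈ Set.Icc (0 : ℝ) n, |p.eval x| ≤ A := by
    simpa using h p 1 ((Nat.cast_le.mpr hp.natDegree_le).trans hd)
      fun k => hp.abs_eval_natCast_le_one
  have hexp : A * Real.exp (2 * d * √(1 / (n - 0))) ≤ L := by
    have hsqrt := mul_sqrt_div_le_of_le_mul_sqrt (ρ := 1) hn0 hd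
    rw [Real.sqrt_one, mul_one] at hsqrt
    rw [sub_zero, mul_assoc]
    exact mul_le_mul_of_nonneg_left (Real.exp_le_exp.mpr (by linarith)) hA.le
  refine ⟨p, hp, fun x hx y hy => abs_eval_sub_le_of_abs_eval_derivative_le (fun z hz => ?_) hx hy,
    fun x hx => abs_eval_le_of_abs_eval_natCast_le hn
      (fun k hk => hp.abs_eval_le k (hK0.trans_le hk.1) (hk.2.trans (Nat.sub_le n K)))
      (fun z hz => ?_) hx⟩
  · have hMarkov := abs_eval_derivative_le hp.natDegree_le hn0 hbound one_pos hz
    rw [div_one] at hMarkov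
    exact hMarkov.trans hexp
  · refine (abs_eval_derivative_le_div_sqrt hp.natDegree_le hbound hK4 (by rwa [zero_add])).trans ?_
    rw [div_le_iff₀ (Real.sqrt_pos.mpr (by linarith))]
    exact hexp.trans hKL

lemma eval_T_le (k : ℕ) {u : ℝ} (hu : 1 ≤ u) (h : (k : ℝ) ^ 2 * (u - 1) ≤ 1) :
    (Chebyshev.T ℝ k).eval u ≤ 1 + k ^ 2 * (u - 1) + (k ^ 2 * (u - 1)) ^ 2 := by
  have h0 : 0 ≤ (k : ℝ) ^ 2 * (u - 1) := mul_nonneg (by positivity) (by linarith)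
  have hexp := (abs_le.mp (Real.abs_exp_sub_one_sub_id_le
    (x := (k : ℝ) ^ 2 * (u - 1)) (by rwa [abs_of_nonneg h0]))).2
  suffices (Chebyshev.T ℝ k).eval u ≤ Real.exp (k ^ 2 * (u - 1)) by linarith
  obtain ⟨s, rfl⟩ : ∃ s, Real.cosh s = u := ⟨_, Real.cosh_arcosh hu⟩
  rw [Chebyshev.T_real_cosh, Int.cast_natCast]
  refine (Real.cosh_le_exp_half_sq (k * s)).trans (Real.exp_le_exp.mpr ?_)
  rw [mul_pow, mul_div_assoc]
  gcongr
  linarith [one_add_sq_div_two_le_cosh s]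

lemma eval_T_rescaled_mem_Icc {k : ℕ} {m τ x₀ x : ℝ} (hm : 0 < m) (hτ : 0 ≤ τ)
    (hτk : τ * m = k ^ 2) (hsmall : 2 * τ * x₀ ≤ 1) (hx : x ∈ Set.Icc 0 x₀) :
    (Chebyshev.T ℝ k).eval (1 + 2 * x₀ / m - 2 / m * x) ∈
      Set.Icc (1 + 2 * τ * (x₀ - x)) (1 + 2 * τ * (x₀ - x) + (2 * τ * x₀) ^ 2) := by
  have hsub : 0 ≤ x₀ - x := sub_nonneg.mpr hx.2
  have hu : 1 ≤ 1 + 2 * x₀ / m - 2 / m * x := by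
    have : 0 ≤ 2 / m * (x₀ - x) := by positivity
    linarith [this.trans_eq (show 2 / m * (x₀ - x) = 2 * x₀ / m - 2 / m * x by ring)]
  have hw : (k : ℝ) ^ 2 * ((1 + 2 * x₀ / m - 2 / m * x) - 1) = 2 * τ * (x₀ - x) := by
    rw [← hτk]
    field_simp
    ring
  have hle : 2 * τ * (x₀ - x) ≤ 2 * τ * x₀ := by gcongr; linarith [hx.1]
  have hlower := one_add_sq_mul_le_eval_T k hu
  have hupper := eval_T_le k hu (by rw [hw]; linarith)
  rw [hw] at hlower hupper
  have hsq : (2 * τ * (x₀ - x)) ^ 2 ≤ (2 * τ * x₀) ^ 2 := by gcongr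
  exact ⟨hlower, by linarith⟩

lemma abs_one_add_div_sub_le_one {m x₀ x : ℝ} (hm : 0 < m) (hx₀ : 0 ≤ x₀)
    (hx : x ∈ Set.Icc x₀ m) : |1 + 2 * x₀ / m - 2 / m * x| ≤ 1 := by
  rw [show 1 + 2 * x₀ / m - 2 / m * x = (m + 2 * (x₀ - x)) / m by field_simp; ring, abs_le,
    le_div_iff₀ hm, div_le_iff₀ hm]
  constructor <;> linarith [hx.1, hx.2]

/-- The Chebyshev polynomial of degree `k` for the interval `[x₀, m]`, reflected and shifted so as
to vanish at `0`. Its slope varies little on `[0, x₀]`, where a multiple of it is close to the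
identity. -/
noncomputable def chebyshevDrop (k : ℕ) (m x₀ : ℝ) : ℝ[X] :=
  C ((Chebyshev.T ℝ k).eval (1 + 2 * x₀ / m)) -
    (Chebyshev.T ℝ k).comp (C (1 + 2 * x₀ / m) - C (2 / m) * X)

lemma natDegree_chebyshevDrop_le (k : ℕ) (m x₀ : ℝ) : (chebyshevDrop k m x₀).natDegree ≤ k := by
  refine (natDegree_sub_le _ _).trans ?_
  rw [natDegree_C]
  exact max_le (Nat.zero_le _) (natDegree_T_comp_le _ _ _)

lemma eval_chebyshevDrop (k : ℕ) (m x₀ x : ℝ) :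
    (chebyshevDrop k m x₀).eval x = (Chebyshev.T ℝ k).eval (1 + 2 * x₀ / m) -
      (Chebyshev.T ℝ k).eval (1 + 2 * x₀ / m - 2 / m * x) := by
  simp [chebyshevDrop]

lemma abs_eval_chebyshevDrop_sub_le {k : ℕ} {m τ x₀ x : ℝ} (hm : 0 < m) (hτ : 0 ≤ τ)
    (hτk : τ * m = k ^ 2) (hsmall : 2 * τ * x₀ ≤ 1) (hx : x ∈ Set.Icc 0 x₀) :
    |(chebyshevDrop k m x₀).eval x - 2 * τ * x| ≤ (2 * τ * x₀) ^ 2 := by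
  have hzero := eval_T_rescaled_mem_Icc hm hτ hτk hsmall ⟨le_rfl, hx.1.trans hx.2⟩
  have hTx := eval_T_rescaled_mem_Icc hm hτ hτk hsmall hx
  rw [mul_zero, sub_zero, sub_zero, Set.mem_Icc] at hzero
  rw [eval_chebyshevDrop]
  exact abs_le.mpr ⟨by linarith [hTx.2], by linarith [hTx.1]⟩

lemma eval_chebyshevDrop_mem_Icc {k : ℕ} {m τ x₀ x : ℝ} (hm : 0 < m) (hτ : 0 ≤ τ)
    (hτk : τ * m = k ^ 2) (hsmall : 2 * τ * x₀ ≤ 1) (hx₀ : 0 ≤ x₀) (hx : x ∈ Set.Icc x₀ m) :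
    (chebyshevDrop k m x₀).eval x ∈ Set.Icc (2 * τ * x₀) (4 * τ * x₀ + 2) := by
  have hzero := eval_T_rescaled_mem_Icc hm hτ hτk hsmall ⟨le_rfl, hx₀⟩
  rw [mul_zero, sub_zero, sub_zero, Set.mem_Icc] at hzero
  have hTx := abs_le.mp
    (Chebyshev.abs_eval_T_real_le_one k (abs_one_add_div_sub_le_one hm hx₀ hx))
  have hsq : (2 * τ * x₀) ^ 2 ≤ 2 * τ * x₀ := by
    rw [sq]
    exact mul_le_of_le_one_left (by positivity) hsmall
  rw [eval_chebyshevDrop]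
  constructor <;> linarith [hTx.1, hTx.2]

lemma exists_rescaling {k : ℕ} {m η τ x₀ : ℝ} (hm : 0 < m) (hη0 : 0 ≤ η) (hη1 : η ≤ 1)
    (hτ : 0 < τ) (hτk : τ * m = k ^ 2) (hx₀ : 0 ≤ x₀) (hsmall : 2 * τ * x₀ ≤ 1) :
    ∃ φ : ℝ[X], φ.natDegree ≤ k ∧ φ.eval 0 = 0 ∧
      (∀ x ∈ Set.Icc 0 x₀, |φ.eval x - x| ≤ η * x₀ + 2 * τ * x₀ ^ 2) ∧
      ∀ x ∈ Set.Icc x₀ m, φ.eval x ∈ Set.Icc ((1 - η) * x₀) (2 * x₀ + (1 - η) / τ) := by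
  have : 0 ≤ 1 - η := by linarith
  set ψ := chebyshevDrop k m x₀
  have hψ0 : ψ.eval 0 = 0 := by simp [ψ, eval_chebyshevDrop]
  refine ⟨C ((1 - η) / (2 * τ)) * ψ,
    (natDegree_C_mul_le _ _).trans (natDegree_chebyshevDrop_le k m x₀), by simp [hψ0],
    fun x hx => ?_, fun x hx => ?_⟩ <;> rw [eval_mul, eval_C]
  · calc |(1 - η) / (2 * τ) * ψ.eval x - x|
        = |(1 - η) / (2 * τ) * (ψ.eval x - 2 * τ * x) - η * x| := by
          congr 1
          field_simp
          ring
      _ ≤ (1 - η) / (2 * τ) * (2 * τ * x₀) ^ 2 + η * x₀ := by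
          refine (abs_sub _ _).trans ?_
          rw [abs_mul, abs_of_nonneg (a := _ / _) (by positivity),
            abs_of_nonneg (mul_nonneg hη0 hx.1)]
          gcongr
          exacts [abs_eval_chebyshevDrop_sub_le hm hτ.le hτk hsmall hx, hx.2]
      _ = (1 - η) * (2 * τ * x₀ ^ 2) + η * x₀ := by field_simp
      _ ≤ 1 * (2 * τ * x₀ ^ 2) + η * x₀ := by gcongr; linarith
      _ = η * x₀ + 2 * τ * x₀ ^ 2 := by ring
  · obtain ⟨hlower, hupper⟩ := eval_chebyshevDrop_mem_Icc hm hτ.le hτk hsmall hx₀ hx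
    constructor
    · calc (1 - η) * x₀ = (1 - η) / (2 * τ) * (2 * τ * x₀) := by field_simp
        _ ≤ (1 - η) / (2 * τ) * ψ.eval x := by gcongr
    · calc (1 - η) / (2 * τ) * ψ.eval x ≤ (1 - η) / (2 * τ) * (4 * τ * x₀ + 2) := by gcongr
        _ = (1 - η) * (2 * x₀) + (1 - η) / τ := by field_simp; ring
        _ ≤ 1 * (2 * x₀) + (1 - η) / τ := by gcongr; linarith
        _ = 2 * x₀ + (1 - η) / τ := by rw [one_mul]

/-- The composition `p ∘ φ` competes in the problem that defines `minDev m d'`. -/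
lemma IsRegularExtremal.minDev_le_add {n d K m d' : ℕ} {L ε μ : ℝ} {p φ : ℝ[X]}
    (hp : IsRegularExtremal n d K L ε p) (hK : 0 < K) (hKn : 2 * K < n) (hL : 0 ≤ L)
    (hμ1 : μ ≤ 1) (hμ : L * μ ≤ ε) (hφd : φ.natDegree * d ≤ d') (hφ0 : φ.eval 0 = 0)
    (hnear : ∀ x ∈ Set.Icc (0 : ℝ) (2 * K), |φ.eval x - x| ≤ μ)
    (hfar : ∀ x ∈ Set.Icc (2 * K : ℝ) m, φ.eval x ∈ Set.Icc (K : ℝ) (n - K)) :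
    minDev m d' ≤ minDev n d + ε := by
  have hε : 0 ≤ ε :=
    (mul_nonneg hL ((abs_nonneg _).trans (hnear 0 ⟨le_rfl, by positivity⟩))).trans hμ
  refine minDev_le (p := p.comp φ) ?_ (by rw [eval_comp, hφ0, hp.eval_zero])
    (add_nonneg (minDev_nonneg n d) hε) fun j hj1 hjm => ?_
  · rw [natDegree_comp, mul_comm]
    exact (Nat.mul_le_mul_left _ hp.natDegree_le).trans hφd
  rw [eval_comp]
  rcases le_total j (2 * K) with hj | hj
  · have hj1' : (1 : ℝ) ≤ j := by exact_mod_cast hj1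
    have hj' : (j : ℝ) ≤ 2 * K := by exact_mod_cast hj
    have hKn' : (2 * K + 1 : ℝ) ≤ n := by exact_mod_cast hKn
    have hφj := hnear j ⟨by linarith, hj'⟩
    have hφj1 := abs_le.mp (hφj.trans hμ1)
    have hLip := hp.abs_eval_sub_le (φ.eval (j : ℝ)) ⟨by linarith, by linarith⟩ j
      ⟨by linarith, by linarith⟩
    have hLμ : L * |φ.eval (j : ℝ) - j| ≤ ε := (mul_le_mul_of_nonneg_left hφj hL).trans hμ
    linarith [hp.abs_eval_le j hj1 (by omega),
      abs_sub_abs_le_abs_sub (p.eval (φ.eval (j : ℝ))) (p.eval (j : ℝ))]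
  · exact hp.abs_eval_le_add _ (hfar j ⟨by exact_mod_cast hj, by exact_mod_cast hjm⟩)

lemma IsRegularExtremal.minDev_le_add_of_rescaling {n d K m d' k : ℕ} {L ε μ η τ : ℝ} {p : ℝ[X]}
    (hp : IsRegularExtremal n d K L ε p) (hK : 0 < K) (hKn : 2 * K < n) (hL : 0 ≤ L)
    (hμ1 : μ ≤ 1) (hμ : L * μ ≤ ε) (hm : 0 < m) (hη0 : 0 ≤ η) (hη : η ≤ 1 / 2) (hτ : 0 < τ)
    (hτk : τ * m = k ^ 2) (hkd : k * d ≤ d') (hημ : 2 * K * η + 8 * K ^ 2 * τ ≤ μ)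
    (hn : 1 - η ≤ (n - 5 * K) * τ) : minDev m d' ≤ minDev n d + ε := by
  have hK1 : (1 : ℝ) ≤ K := by exact_mod_cast hK
  have hsmall : 2 * τ * (2 * K : ℝ) ≤ 1 := by
    have : 0 ≤ 2 * K * η := by positivity
    nlinarith
  obtain ⟨φ, hφd, hφ0, hnear, hfar⟩ := exists_rescaling (m := m) (x₀ := 2 * K)
    (by exact_mod_cast hm) hη0 (by linarith) hτ hτk (by positivity) hsmall
  refine hp.minDev_le_add hK hKn hL hμ1 hμ ((Nat.mul_le_mul_right d hφd).trans hkd) hφ0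
    (fun x hx => (hnear x hx).trans (by linarith)) fun x hx => ?_
  have hφx := hfar x hx
  rw [← div_le_iff₀ hτ] at hn
  exact ⟨by nlinarith [hφx.1], by linarith [hφx.2]⟩

lemma tendsto_natDiv_sq_div {d : ℕ → ℕ} {c : ℝ}
    (hd : Tendsto (fun n : ℕ => (d n : ℝ) / √(n : ℝ)) atTop (𝓝 c)) (j : ℕ) :
    Tendsto (fun n : ℕ => ((d n / j : ℕ) : ℝ) ^ 2 / n) atTop (𝓝 ((c / j) ^ 2)) := by
  have hsqrt : Tendsto (fun n : ℕ => (√(n : ℝ))⁻¹) atTop (𝓝 0) :=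
    tendsto_inv_atTop_zero.comp (Real.tendsto_sqrt_atTop.comp tendsto_natCast_atTop_atTop)
  have hdiv : Tendsto (fun n : ℕ => ((d n / j : ℕ) : ℝ) / √(n : ℝ)) atTop (𝓝 (c / j)) := by
    have hupper := hd.div_const (j : ℝ)
    have hlower : Tendsto (fun n : ℕ => (d n : ℝ) / √(n : ℝ) / j - (√(n : ℝ))⁻¹) atTop
        (𝓝 (c / j)) := by simpa using hupper.sub hsqrt
    refine tendsto_of_tendsto_of_tendsto_of_le_of_le hlower hupper (fun n => ?_) fun n => ?_
    · have hfloor : (d n : ℝ) / j - 1 ≤ ((d n / j : ℕ) : ℝ) := by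
        rw [← Nat.floor_div_eq_div (K := ℝ)]
        exact (Nat.sub_one_lt_floor _).le
      calc (d n : ℝ) / √(n : ℝ) / j - (√(n : ℝ))⁻¹ = ((d n : ℝ) / j - 1) / √(n : ℝ) := by ring
        _ ≤ _ := by gcongr
    · dsimp only
      rw [div_right_comm]
      gcongr
      exact Nat.cast_div_le
  refine (hdiv.pow 2).congr fun n => ?_
  rw [div_pow, Real.sq_sqrt (Nat.cast_nonneg n)]

lemma exists_tendsto_of_eventually_le_add {a : ℕ → ℝ} (hbelow : BddBelow (Set.range a))
    (habove : BddAbove (Set.range a))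
    (h : ∀ ε : ℝ, 0 < ε → ∀ᶠ n in atTop, ∀ᶠ m in atTop, a m ≤ a n + ε) :
    ∃ l, Tendsto a atTop (𝓝 l) := by
  have hle : IsBoundedUnder (· ≤ ·) atTop a := habove.isBoundedUnder_of_range
  have hge : IsBoundedUnder (· ≥ ·) atTop a := hbelow.isBoundedUnder_of_range
  refine ⟨limsup a atTop, tendsto_of_le_liminf_of_limsup_le ?_ le_rfl hle hge⟩
  refine le_of_forall_pos_le_add fun ε hε => sub_le_iff_le_add.mp ?_
  refine le_liminf_of_le hle.isCoboundedUnder_ge ?_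
  filter_upwards [h ε hε] with n hn
  exact sub_le_iff_le_add.mpr (limsup_le_of_le hge.isCoboundedUnder_le hn)

lemma tendsto_mul_div_sq {d : ℕ → ℕ} {c : ℝ} (hc : 0 < c)
    (hd : Tendsto (fun n : ℕ => (d n : ℝ) / √(n : ℝ)) atTop (𝓝 c)) :
    Tendsto (fun n : ℕ => (n : ℝ) * (c / d n) ^ 2) atTop (𝓝 1) := by
  have hsq : Tendsto (fun n : ℕ => (c / ((d n : ℝ) / √(n : ℝ))) ^ 2) atTop (𝓝 ((c / c) ^ 2)) :=
    ((tendsto_const_nhds (x := c)).div hd hc.ne').pow 2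
  rw [div_self hc.ne', one_pow] at hsq
  refine hsq.congr fun n => ?_
  rw [div_div_eq_mul_div, div_pow, mul_pow, Real.sq_sqrt (Nat.cast_nonneg n), div_pow]
  ring

lemma eventually_minDev_le_add {d : ℕ → ℕ} {c ε : ℝ} (hc : 0 < c)
    (hd : Tendsto (fun n : ℕ => (d n : ℝ) / √(n : ℝ)) atTop (𝓝 c)) (hε : 0 < ε) :
    ∀ᶠ n in atTop, ∀ᶠ m in atTop, minDev m (d m) ≤ minDev n (d n) + ε := by
  obtain ⟨K, L, hK, hL, hreg⟩ := exists_isRegularExtremal (2 * c) hε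
  have : (0 : ℝ) < K := Nat.cast_pos.mpr hK
  set μ : ℝ := min (ε / L) 1
  have : 0 < μ := by positivity
  have hLμ : L * μ ≤ ε := (le_div_iff₀' hL).mp (min_le_left _ _)
  set η : ℝ := min (μ / (4 * K)) (1 / 2)
  have hη : 0 < η := by positivity
  have hηK : 2 * K * η ≤ μ / 2 := by
    have := (le_div_iff₀' (by positivity)).mp (min_le_left (μ / (4 * K)) (1 / 2))
    linarith
  have hτ : Tendsto (fun n : ℕ => (c / d n) ^ 2) atTop (𝓝 0) := by
    refine ((tendsto_mul_div_sq hc hd).div_atTop tendsto_natCast_atTop_atTop).congr' ?_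
    filter_upwards [eventually_ne_atTop 0] with n hn
    exact mul_div_cancel_left₀ _ (Nat.cast_ne_zero.mpr hn)
  have hnτ : Tendsto (fun n : ℕ => (n - 5 * K : ℝ) * (c / d n) ^ 2) atTop (𝓝 1) := by
    simpa [sub_mul] using (tendsto_mul_div_sq hc hd).sub (hτ.const_mul (5 * K : ℝ))
  have hdeg : ∀ᶠ n : ℕ in atTop, (d n : ℝ) ≤ 2 * c * √n := by
    filter_upwards [hd.eventually_le_const (by linarith : c < 2 * c), eventually_gt_atTop 0]
      with n hn hn0
    exact (div_le_iff₀ (Real.sqrt_pos.mpr (Nat.cast_pos.mpr hn0))).mp hn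
  filter_upwards [hreg, hdeg, eventually_gt_atTop (2 * K), hd.eventually_const_lt hc,
    hτ.eventually_lt_const (by positivity : 0 < μ / (16 * K ^ 2)),
    hnτ.eventually_const_lt (by linarith : 1 - η < 1)] with n hreg hdeg hn hdn hτn hnτn
  obtain ⟨p, hp⟩ := hreg (d n) hdeg
  have hlim := tendsto_natDiv_sq_div hd (d n)
  have hdn0 : (0 : ℝ) < d n :=
    (Nat.cast_nonneg _).lt_of_ne fun h => by simp [← h] at hdn
  filter_upwards [eventually_gt_atTop 0, hlim.eventually_const_lt (by positivity),
    hlim.eventually_lt_const hτn, (hlim.const_mul _).eventually_const_lt hnτn]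
    with m hm hτ0 hτ1 hτ2
  refine hp.minDev_le_add_of_rescaling hK hn hL.le (min_le_right _ _) hLμ hm hη.le
    (min_le_right _ _) hτ0 (div_mul_cancel₀ _ (by positivity)) (Nat.div_mul_le_self _ _) ?_ hτ2.le
  rw [lt_div_iff₀ (by positivity)] at hτ1
  linarith

theorem exists_tendsto_minDev {d : ℕ → ℕ} {c : ℝ} (hc : 0 < c)
    (hd : Tendsto (fun n : ℕ => (d n : ℝ) / √(n : ℝ)) atTop (𝓝 c)) :
    ∃ l, Tendsto (fun n => minDev n (d n)) atTop (𝓝 l) :=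
  exists_tendsto_of_eventually_le_add
    ⟨0, Set.forall_mem_range.mpr fun n => minDev_nonneg n (d n)⟩
    ⟨1, Set.forall_mem_range.mpr fun n => minDev_le_one n (d n)⟩
    fun _ => eventually_minDev_le_add hc hd

end Comparison

/-! ### Asymptotics of the discrete Chebyshev problem -/

section MinDevAsymptotics

lemma sq_div_le_one {x y : ℝ} (hx : 0 ≤ x) (hy : 0 ≤ y) (hxy : x ≤ √y) : x ^ 2 / y ≤ 1 :=
  div_le_one_of_le₀ ((Real.le_sqrt hx hy).mp hxy) hy

theorem isTheta_one_sub_minDev_sq {d : ℕ → ℕ}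
    (hd : (fun n : ℕ => (d n : ℝ)) =o[atTop] (fun n : ℕ => √(n : ℝ))) :
    (fun n : ℕ => 1 - minDev n (d n) ^ 2) =Θ[atTop] (fun n : ℕ => (d n : ℝ) ^ 2 / (n : ℝ)) := by
  obtain ⟨c, hc⟩ := exists_one_sub_minDev_le
  have hle : ∀ᶠ n : ℕ in atTop, (d n : ℝ) ≤ √(n : ℝ) := by
    filter_upwards [hd.bound one_pos] with n hn
    simpa [abs_of_nonneg (Real.sqrt_nonneg _)] using hn
  have hminDev : ∀ n, minDev n (d n) ∈ Set.Icc 0 1 :=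
    fun n => ⟨minDev_nonneg _ _, minDev_le_one _ _⟩
  have hnonneg : ∀ n, 0 ≤ 1 - minDev n (d n) ^ 2 := fun n =>
    sub_nonneg.mpr (pow_le_one₀ (hminDev n).1 (hminDev n).2)
  refine ⟨IsBigO.of_bound (2 * c) ?_, IsBigO.of_bound (3 / 2) ?_⟩
  · filter_upwards [hc, hle] with n hn hdn
    rw [Real.norm_of_nonneg (hnonneg n), Real.norm_of_nonneg (by positivity)]
    calc 1 - minDev n (d n) ^ 2 = (1 + minDev n (d n)) * (1 - minDev n (d n)) := by ring
      _ ≤ 2 * (1 - minDev n (d n)) := by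
        have := hminDev n
        gcongr <;> linarith [this.1, this.2]
      _ ≤ 2 * c * ((d n : ℝ) ^ 2 / n) := by rw [mul_assoc]; gcongr; exact hn (d n) hdn
  · filter_upwards [hle, eventually_ge_atTop 2] with n hdn hn
    rw [Real.norm_of_nonneg (by positivity), Real.norm_of_nonneg (hnonneg n)]
    have hx1 := sq_div_le_one (Nat.cast_nonneg (d n)) (Nat.cast_nonneg n) hdn
    set x : ℝ := (d n : ℝ) ^ 2 / n
    have hx0 : 0 ≤ x := by positivity
    have hm : minDev n (d n) ≤ 1 - 2 / 3 * x := by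
      refine (minDev_le_inv hn (d n)).trans ((inv_le_iff_one_le_mul₀ (by positivity)).mpr ?_)
      nlinarith
    have hsq : minDev n (d n) ^ 2 ≤ minDev n (d n) :=
      pow_le_of_le_one (hminDev n).1 (hminDev n).2 two_ne_zero
    linarith

theorem minDev_sq_mem_Icc {d : ℕ → ℕ} {c C : ℝ} (hc : 0 < c)
    (hlower : ∀ᶠ n : ℕ in atTop, c * √(n : ℝ) ≤ d n)
    (hupper : ∀ᶠ n : ℕ in atTop, (d n : ℝ) ≤ C * √(n : ℝ)) :
    ∃ a b : ℝ, 0 < a ∧ b < 1 ∧ ∀ᶠ n : ℕ in atTop, minDev n (d n) ^ 2 ∈ Set.Icc a b := by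
  obtain ⟨a, ha, hC⟩ := exists_le_minDev C
  refine ⟨a ^ 2, ((1 + 2 * c ^ 2)⁻¹) ^ 2, by positivity, ?_, ?_⟩
  · have hinv : (1 + 2 * c ^ 2)⁻¹ < 1 := inv_lt_one_of_one_lt₀ (by linarith [pow_pos hc 2])
    exact pow_lt_one₀ (by positivity) hinv two_ne_zero
  · filter_upwards [hlower, hupper, hC, eventually_ge_atTop 2] with n hcd hdC hle hn
    have hn0 : (0 : ℝ) < n := by exact_mod_cast (by omega : 0 < n)
    refine ⟨pow_le_pow_left₀ ha.le (hle _ hdC) 2, pow_le_pow_left₀ (minDev_nonneg _ _) ?_ 2⟩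
    refine (minDev_le_inv hn (d n)).trans ?_
    have hcd2 : c ^ 2 ≤ (d n : ℝ) ^ 2 / n := by
      rw [le_div_iff₀ hn0]
      calc c ^ 2 * n = (c * √(n : ℝ)) ^ 2 := by rw [mul_pow, Real.sq_sqrt hn0.le]
        _ ≤ _ := by gcongr
    gcongr

theorem minDev_sq_mem_Icc_of_isTheta {d : ℕ → ℕ}
    (hd : (fun n : ℕ => (d n : ℝ)) =Θ[atTop] (fun n : ℕ => √(n : ℝ))) :
    ∃ a b : ℝ, 0 < a ∧ b < 1 ∧ ∀ᶠ n : ℕ in atTop, minDev n (d n) ^ 2 ∈ Set.Icc a b := by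
  obtain ⟨C, -, hC⟩ := hd.1.exists_pos
  obtain ⟨c, hc0, hc⟩ := hd.2.exists_pos
  refine minDev_sq_mem_Icc (c := c⁻¹) (C := C) (inv_pos.mpr hc0) ?_ ?_
  · filter_upwards [hc.bound] with n hn
    rw [Real.norm_of_nonneg (Nat.cast_nonneg _), Real.norm_of_nonneg (Real.sqrt_nonneg _)] at hn
    rwa [inv_mul_le_iff₀ hc0]
  · filter_upwards [hC.bound] with n hn
    rwa [Real.norm_of_nonneg (Nat.cast_nonneg _), Real.norm_of_nonneg (Real.sqrt_nonneg _)] at hn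

theorem exists_tendsto_minDev_sq {d : ℕ → ℕ} {c : ℝ} (hc : 0 < c)
    (hd : Tendsto (fun n : ℕ => (d n : ℝ) / √(n : ℝ)) atTop (𝓝 c)) :
    ∃ l ∈ Set.Ioo (0 : ℝ) 1, Tendsto (fun n : ℕ => minDev n (d n) ^ 2) atTop (𝓝 l) := by
  obtain ⟨l, hl⟩ := exists_tendsto_minDev hc hd
  obtain ⟨a, b, ha, hb, hab⟩ :=
    minDev_sq_mem_Icc_of_isTheta (isTheta_of_div_tendsto_nhds_ne_zero hd hc.ne').symm
  have hmem : l ^ 2 ∈ Set.Icc a b := isClosed_Icc.mem_of_tendsto (hl.pow 2) hab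
  exact ⟨l ^ 2, ⟨ha.trans_le hmem.1, hmem.2.trans_lt hb⟩, hl.pow 2⟩

theorem isBigO_minDev_sq (d : ℕ → ℕ) : (fun n : ℕ => minDev n (d n) ^ 2) =O[atTop]
    (fun n : ℕ => Real.exp (-4 * (d n : ℝ) / √(n : ℝ))) := by
  refine IsBigO.of_bound 4 ?_
  filter_upwards [eventually_ge_atTop 2] with n hn
  rw [Real.norm_of_nonneg (by positivity), Real.norm_of_nonneg (by positivity)]
  calc minDev n (d n) ^ 2 ≤ (2 * Real.exp (-2 * d n / √n)) ^ 2 :=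
        pow_le_pow_left₀ (minDev_nonneg _ _) (minDev_le_exp hn (d n)) 2
    _ = 4 * Real.exp (-4 * d n / √n) := by
        rw [mul_pow, ← Real.exp_nat_mul]
        congr 2
        · norm_num
        · push_cast; ring

end MinDevAsymptotics

/-! ### Linear forms in the signals -/

section LinearForms

open scoped Matrix

variable {n : ℕ}

lemma measurable_dotProduct {ι : Type*} [Fintype ι] (b : ι → ℝ) : Measurable (b ⬝ᵥ ·) := by
  unfold dotProduct
  fun_prop

lemma target_eq_one_dotProduct : (target : Signals n → ℝ) = (1 ⬝ᵥ ·) := by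
  funext x
  rw [one_dotProduct, target]

lemma measurable_target : Measurable (target : Signals n → ℝ) :=
  target_eq_one_dotProduct ▸ measurable_dotProduct 1

lemma Prior.memLp_coord (D : Prior n) (T : Finset (Fin n)) :
    MemLp (fun x : Signals n => x T) 2 D.law :=
  (D.memLp_two T).comp_measurePreserving (measurePreserving_eval D.dist T)

lemma Prior.memLp_dotProduct (D : Prior n) (b : Finset (Fin n) → ℝ) :
    MemLp (b ⬝ᵥ · : Signals n → ℝ) 2 D.law :=
  memLp_finsetSum _ fun T _ => (D.memLp_coord T).const_mul (b T)

lemma Prior.integrable_dotProduct (D : Prior n) (b : Finset (Fin n) → ℝ) :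
    Integrable (b ⬝ᵥ · : Signals n → ℝ) D.law :=
  (D.memLp_dotProduct b).integrable one_le_two

lemma Prior.integral_coord (D : Prior n) (T : Finset (Fin n)) :
    ∫ x : Signals n, x T ∂D.law = 0 := by
  rw [Prior.law, integral_eval, D.mean_zero]

lemma Prior.integral_dotProduct (D : Prior n) (b : Finset (Fin n) → ℝ) :
    ∫ x : Signals n, b ⬝ᵥ x ∂D.law = 0 := by
  unfold dotProduct
  rw [integral_finsetSum _ fun T _ => ((D.memLp_coord T).integrable one_le_two).const_mul _]
  exact Finset.sum_eq_zero fun T _ => by rw [integral_const_mul, D.integral_coord, mul_zero]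

lemma Prior.variance_dotProduct (D : Prior n) (b : Finset (Fin n) → ℝ) :
    variance (b ⬝ᵥ · : Signals n → ℝ) D.law =
      ∑ T, b T ^ 2 * variance (fun x : ℝ => x) (D.dist T) := by
  have hsum : (b ⬝ᵥ · : Signals n → ℝ) = ∑ T, fun x => b T * x T := by
    funext x
    rw [Finset.sum_apply, dotProduct]
  rw [hsum, Prior.law,
    variance_sum_pi (X := fun T y => b T * y) fun T => (D.memLp_two T).const_mul (b T)]
  exact Finset.sum_congr rfl fun T _ => variance_const_mul _ _ _

lemma Prior.lintegral_dotProduct_sq (D : Prior n) (b : Finset (Fin n) → ℝ) :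
    ∫⁻ x : Signals n, ENNReal.ofReal ((b ⬝ᵥ x) ^ 2) ∂D.law =
      ENNReal.ofReal (∑ T, b T ^ 2 * variance (fun x : ℝ => x) (D.dist T)) := by
  rw [← D.variance_dotProduct, ← ofReal_integral_eq_lintegral_ofReal
    (D.memLp_dotProduct b).integrable_sq (Eventually.of_forall fun _ => sq_nonneg _),
    variance_of_integral_eq_zero (measurable_dotProduct b).aemeasurable (D.integral_dotProduct b)]

lemma Prior.lintegral_sub_target_sq (D : Prior n) {f : Signals n → ℝ} {c : Finset (Fin n) → ℝ}
    (hf : f =ᵐ[D.law] (c ⬝ᵥ ·)) :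
    ∫⁻ x, ENNReal.ofReal ((f x - target x) ^ 2) ∂D.law =
      ENNReal.ofReal (∑ T, (c T - 1) ^ 2 * variance (fun x : ℝ => x) (D.dist T)) := by
  refine Eq.trans (lintegral_congr_ae ?_) (D.lintegral_dotProduct_sq (c - 1))
  filter_upwards [hf] with x hx
  rw [hx, target_eq_one_dotProduct, sub_dotProduct]

/-- The coefficients of the part of a linear form in the signals that expert `i` observes. -/
def restrictTo (i : Fin n) : (Finset (Fin n) → ℝ) →ₗ[ℝ] Finset (Fin n) → ℝ where
  toFun b T := if i ∈ T then b T else 0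
  map_add' a b := by
    funext T
    split_ifs with hT <;> simp [hT]
  map_smul' r b := by
    funext T
    split_ifs with hT <;> simp [hT]

lemma restrictTo_apply (i : Fin n) (b : Finset (Fin n) → ℝ) (T : Finset (Fin n)) :
    restrictTo i b T = if i ∈ T then b T else 0 := rfl

lemma restrictTo_restrictTo (i : Fin n) (b : Finset (Fin n) → ℝ) :
    restrictTo i (restrictTo i b) = restrictTo i b := by
  funext T
  simp only [restrictTo_apply]
  split_ifs <;> rfl

lemma restrictTo_dotProduct (i : Fin n) (b x : Finset (Fin n) → ℝ) :
    restrictTo i b ⬝ᵥ x = b ⬝ᵥ restrictTo i x :=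
  Finset.sum_congr rfl fun T _ => by
    simp only [restrictTo_apply, ite_mul, mul_ite, zero_mul, mul_zero]

lemma measurable_observe (i : Fin n) : Measurable (observe i) := by
  unfold observe
  fun_prop

lemma restrictTo_dotProduct_eq_observe (i : Fin n) (b : Finset (Fin n) → ℝ) (x : Signals n) :
    restrictTo i b ⬝ᵥ x = (fun T : {T : Finset (Fin n) // i ∈ T} => b T) ⬝ᵥ observe i x := by
  simp only [dotProduct, restrictTo_apply, ite_mul, zero_mul, observe]
  rw [← Finset.sum_filter]
  exact Finset.sum_subtype _ (by simp) fun T => b T * x T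

lemma measurable_agentSigma_restrictTo_dotProduct (i : Fin n) (b : Finset (Fin n) → ℝ) :
    Measurable[agentSigma i] (restrictTo i b ⬝ᵥ · : Signals n → ℝ) := by
  simp only [restrictTo_dotProduct_eq_observe]
  exact (measurable_dotProduct _).comp (comap_measurable _)

lemma Prior.indep_agentSigma (D : Prior n) (i : Fin n) (b : Finset (Fin n) → ℝ) :
    Indep (MeasurableSpace.comap ((b - restrictTo i b) ⬝ᵥ · : Signals n → ℝ) inferInstance)
      (agentSigma i) D.law := by
  have hindep : iIndepFun (fun (T : Finset (Fin n)) (x : Signals n) => x T) D.law :=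
    iIndepFun_pi (X := fun _ y => y) fun _ => aemeasurable_id
  have hdisj : Disjoint ({T | i ∉ T} : Finset (Finset (Fin n))) ({T | i ∈ T} : Finset _) := by
    rw [Finset.disjoint_filter]
    exact fun _ _ h => h
  have hunobserved : ((b - restrictTo i b) ⬝ᵥ · : Signals n → ℝ) =
      ((fun T : ({T | i ∉ T} : Finset (Finset (Fin n))) => b T) ⬝ᵥ ·) ∘ fun x T => x T := by
    funext x
    simp only [Function.comp, dotProduct, Pi.sub_apply, restrictTo_apply]
    rw [Finset.sum_coe_sort ({T | i ∉ T} : Finset _) fun T => b T * x T, Finset.sum_filter]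
    exact Finset.sum_congr rfl fun T _ => by by_cases hT : i ∈ T <;> simp [hT]
  rw [hunobserved]
  exact (hindep.indepFun_finset _ _ hdisj fun T => measurable_pi_apply T).comp
    (ψ := fun (s : ({T | i ∈ T} : Finset (Finset (Fin n))) → ℝ)
      (T : {T : Finset (Fin n) // i ∈ T}) => s ⟨T, by simpa using T.2⟩)
    (measurable_dotProduct _) (by fun_prop)

lemma Prior.condExp_dotProduct (D : Prior n) (i : Fin n) (b : Finset (Fin n) → ℝ) :
    (D.law)[(b ⬝ᵥ ·) | agentSigma i] =ᵐ[D.law] (restrictTo i b ⬝ᵥ ·) := by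
  have hle : agentSigma i ≤ (inferInstance : MeasurableSpace (Signals n)) :=
    (measurable_observe i).comap_le
  have hsplit : (b ⬝ᵥ · : Signals n → ℝ) = (restrictTo i b ⬝ᵥ ·) + ((b - restrictTo i b) ⬝ᵥ ·) := by
    funext x
    rw [Pi.add_apply, ← add_dotProduct, add_sub_cancel]
  have hobserved := condExp_of_stronglyMeasurable hle
    (measurable_agentSigma_restrictTo_dotProduct i b).stronglyMeasurable
    (D.integrable_dotProduct (restrictTo i b))
  have hunobserved := condExp_indep_eq (μ := D.law)
    (measurable_dotProduct (b - restrictTo i b)).comap_le hle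
    (comap_measurable _).stronglyMeasurable (D.indep_agentSigma i b)
  rw [hsplit]
  filter_upwards [condExp_add (D.integrable_dotProduct (restrictTo i b))
    (D.integrable_dotProduct (b - restrictTo i b)) (agentSigma i), hunobserved] with x hadd hx
  rw [hadd, Pi.add_apply, hobserved, hx, D.integral_dotProduct, add_zero]

end LinearForms

section TwoPoint

/-- The uniform distribution on `{a, -a}`. -/
noncomputable def twoPoint (a : ℝ) : Measure ℝ :=
  (2⁻¹ : ℝ≥0∞) • Measure.dirac a + (2⁻¹ : ℝ≥0∞) • Measure.dirac (-a)

instance isProbabilityMeasure_twoPoint (a : ℝ) : IsProbabilityMeasure (twoPoint a) :=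
  ⟨by simp [twoPoint, ENNReal.inv_two_add_inv_two]⟩

lemma integrable_half_smul_dirac (a : ℝ) (f : ℝ → ℝ) :
    Integrable f ((2⁻¹ : ℝ≥0∞) • Measure.dirac a) :=
  (integrable_dirac (by simp)).smul_measure (by simp)

lemma integrable_twoPoint (a : ℝ) (f : ℝ → ℝ) : Integrable f (twoPoint a) :=
  (integrable_half_smul_dirac a f).add_measure (integrable_half_smul_dirac (-a) f)

lemma integral_twoPoint (a : ℝ) (f : ℝ → ℝ) : ∫ x, f x ∂twoPoint a = (f a + f (-a)) / 2 := by
  rw [twoPoint, integral_add_measure (integrable_half_smul_dirac a f)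
    (integrable_half_smul_dirac (-a) f), integral_smul_measure, integral_smul_measure,
    integral_dirac, integral_dirac, ENNReal.toReal_inv, ENNReal.toReal_ofNat, smul_eq_mul,
    smul_eq_mul]
  ring

lemma memLp_two_twoPoint (a : ℝ) : MemLp (fun x : ℝ => x) 2 (twoPoint a) :=
  (memLp_two_iff_integrable_sq aestronglyMeasurable_id).mpr (integrable_twoPoint a _)

lemma variance_twoPoint (a : ℝ) : variance (fun x : ℝ => x) (twoPoint a) = a ^ 2 := by
  rw [variance_of_integral_eq_zero aemeasurable_id' (by simp [integral_twoPoint]),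
    integral_twoPoint]
  ring

lemma twoPoint_zero : twoPoint 0 = Measure.dirac 0 := by
  rw [twoPoint, neg_zero, ← add_smul, ENNReal.inv_two_add_inv_two, one_smul]

lemma twoPoint_singleton_ne_zero {a b : ℝ} (hb : b = a ∨ b = -a) : twoPoint a {b} ≠ 0 := by
  rcases hb with rfl | rfl <;> simp [twoPoint]

variable {n : ℕ} {v : Finset (Fin n) → ℝ}

/-- The prior for which `X_T` is uniform on `{v T, -v T}`. -/
noncomputable def symmPrior (v : Finset (Fin n) → ℝ) (hempty : v ∅ = 0) (hne : v ≠ 0) :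
    Prior n where
  dist T := twoPoint (v T)
  isProb _ := inferInstance
  memLp_two T := memLp_two_twoPoint (v T)
  mean_zero T := by simp [integral_twoPoint]
  dist_empty := by rw [hempty, twoPoint_zero]
  exists_var_pos := (Function.ne_iff.mp hne).imp fun T hT => by
    rw [variance_twoPoint]
    exact sq_pos_of_ne_zero hT

lemma variance_symmPrior (hempty : v ∅ = 0) (hne : v ≠ 0) (T : Finset (Fin n)) :
    variance (fun x : ℝ => x) ((symmPrior v hempty hne).dist T) = v T ^ 2 :=
  variance_twoPoint (v T)

lemma of_ae_symmPrior {hempty : v ∅ = 0} {hne : v ≠ 0} {p : Signals n → Prop}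
    (hp : ∀ᵐ x ∂(symmPrior v hempty hne).law, p x) {x : Signals n}
    (hx : ∀ T, x T = v T ∨ x T = -v T) : p x := by
  by_contra hpx
  have hnull : (symmPrior v hempty hne).law {x} = 0 :=
    measure_mono_null (Set.singleton_subset_iff.mpr hpx) (ae_iff.mp hp)
  rw [Prior.law, Measure.pi_singleton, Finset.prod_eq_zero_iff] at hnull
  obtain ⟨T, -, hT⟩ := hnull
  exact twoPoint_singleton_ne_zero (hx T) hT

lemma ae_symmPrior_eq_zero {hempty : v ∅ = 0} {hne : v ≠ 0} {T : Finset (Fin n)} (hT : v T = 0) :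
    ∀ᵐ x ∂(symmPrior v hempty hne).law, x T = 0 := by
  refine (measurePreserving_eval (symmPrior v hempty hne).dist T).quasiMeasurePreserving.ae
    (p := (· = 0)) ?_
  change ∀ᵐ y ∂twoPoint (v T), y = 0
  rw [hT, twoPoint_zero, ae_dirac_eq]
  exact eventually_pure.mpr rfl

end TwoPoint

/-! ### Linear rules and elicitability -/

section Structure

open scoped Matrix

variable {n m : ℕ}

lemma wellFounded_adj {V : Type*} [Finite V] {G : Digraph V}
    (hG : ∀ v, ¬ Relation.TransGen G.Adj v v) : WellFounded fun w v => G.Adj v w := by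
  have : IsTrans V fun w v => Relation.TransGen G.Adj v w := ⟨fun _ _ _ hvw huv => huv.trans hvw⟩
  have : Std.Irrefl fun w v => Relation.TransGen G.Adj v w := ⟨hG⟩
  exact Subrelation.wf (r := fun w v => Relation.TransGen G.Adj v w) Relation.TransGen.single
    (Finite.wellFounded_of_trans_of_irrefl _)

/-- The vectors `c v` are coefficients of the nodes of a query list as linear forms in the signals.
They do not depend on the prior, and those of a query vanish on the signals that the expert asked
does not observe. -/
structure IsNodeCoeff (𝒬 : Fin m → Query n) (c : Option (Fin m) → Finset (Fin n) → ℝ) : Prop where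
  coeff_none : c none = 1
  restrictTo_coeff : ∀ j, restrictTo (𝒬 j).agent (c (some j)) = c (some j)
  nodeVar_ae_eq : ∀ v D, nodeVar 𝒬 v D =ᵐ[D.law] (c v ⬝ᵥ ·)

lemma Prior.condExp_sum_nodeVar (D : Prior n) (𝒬 : Fin m → Query n) (i : Fin n)
    {s : Finset (Option (Fin m))} (a : Option (Fin m) → ℝ)
    {b : Option (Fin m) → Finset (Fin n) → ℝ}
    (hb : ∀ v ∈ s, nodeVar 𝒬 v D =ᵐ[D.law] (b v ⬝ᵥ ·)) :
    (D.law)[fun x => ∑ v ∈ s, a v * nodeVar 𝒬 v D x | agentSigma i] =ᵐ[D.law]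
      (restrictTo i (∑ v ∈ s, a v • b v) ⬝ᵥ ·) := by
  refine (condExp_congr_ae ?_).trans (D.condExp_dotProduct i _)
  filter_upwards [(Finset.eventually_all s).mpr hb] with x hx
  rw [sum_dotProduct]
  exact Finset.sum_congr rfl fun v hv => by rw [smul_dotProduct, hx v hv, smul_eq_mul]

open Classical in
lemma exists_isNodeCoeff {𝒬 : Fin m → Query n} {G : Digraph (Option (Fin m))}
    (hG : ∀ v, ¬ Relation.TransGen G.Adj v v) {α : Fin m → Option (Fin m) → ℝ}
    (hα : ∀ (j : Fin m) (D : Prior n), (𝒬 j).out D =ᵐ[D.law]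
      (D.law)[fun x => ∑ v with G.Adj (some j) v, α j v * nodeVar 𝒬 v D x |
        agentSigma (𝒬 j).agent]) :
    ∃ c, IsNodeCoeff 𝒬 c := by
  have hout : ∀ {b : Option (Fin m) → Finset (Fin n) → ℝ} (j : Fin m),
      (∀ v, G.Adj (some j) v → ∀ D, nodeVar 𝒬 v D =ᵐ[D.law] (b v ⬝ᵥ ·)) → ∀ D,
      (𝒬 j).out D =ᵐ[D.law]
        (restrictTo (𝒬 j).agent (∑ v with G.Adj (some j) v, α j v • b v) ⬝ᵥ ·) :=
    fun j hb D => (hα j D).trans <| D.condExp_sum_nodeVar 𝒬 _ _ fun v hv =>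
      hb v (Finset.mem_filter.mp hv).2 D
  have hnone : ∀ D : Prior n, nodeVar 𝒬 none D =ᵐ[D.law] (1 ⬝ᵥ ·) := fun _ =>
    .of_eq target_eq_one_dotProduct
  have hex : ∀ v, ∃ b : Finset (Fin n) → ℝ, ∀ D, nodeVar 𝒬 v D =ᵐ[D.law] (b ⬝ᵥ ·) := fun v => by
    induction v using (wellFounded_adj hG).induction with
    | _ v ih =>
      cases v with
      | none => exact ⟨1, hnone⟩
      | some j =>
        choose! b hb using ih
        exact ⟨_, hout j hb⟩
  choose b hb using hex
  refine ⟨fun v => v.elim 1 fun j =>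
    restrictTo (𝒬 j).agent (∑ v with G.Adj (some j) v, α j v • b v),
    rfl, fun j => restrictTo_restrictTo _ _, fun v D => ?_⟩
  cases v with
  | none => exact hnone D
  | some j => exact hout j (fun v _ => hb v) D

lemma mem_span_of_forall_dotProduct_eq_zero {K I : Type*} [Field K] [Fintype I]
    {s : Set (I → K)} {q : I → K} (h : ∀ v, (∀ b ∈ s, b ⬝ᵥ v = 0) → q ⬝ᵥ v = 0) :
    q ∈ Submodule.span K s := by
  classical
  by_contra hq
  obtain ⟨f, hfq, hf⟩ := Submodule.exists_le_ker_of_notMem hq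
  obtain ⟨v, rfl⟩ := (dotProductEquiv K I).surjective f
  refine hfq ?_
  rw [dotProductEquiv_apply_apply, dotProduct_comm]
  refine h v fun b hb => ?_
  rw [dotProduct_comm, ← dotProductEquiv_apply_apply]
  exact hf (Submodule.subset_span hb)

lemma Prior.condDistrib_observe_ae_eq_dirac (D : Prior n) {κ : Type*} [Countable κ] (i : Fin n)
    {R : κ → Signals n → ℝ} {c : κ → Finset (Fin n) → ℝ}
    (hR : ∀ u, R u =ᵐ[D.law] (restrictTo i (c u) ⬝ᵥ ·)) :
    ∀ᵐ x ∂D.law, condDistrib (fun y u => R u y) (observe i) D.law (observe i x) =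
      Measure.dirac fun u => restrictTo i (c u) ⬝ᵥ x := by
  have hmeas : Measurable fun (s : AgentSignals i) u =>
      (fun T : {T : Finset (Fin n) // i ∈ T} => c u T) ⬝ᵥ s :=
    measurable_pi_lambda _ fun u => measurable_dotProduct _
  have hcongr : (fun y u => R u y) =ᵐ[D.law] (fun (s : AgentSignals i) u =>
      (fun T : {T : Finset (Fin n) // i ∈ T} => c u T) ⬝ᵥ s) ∘ observe i := by
    filter_upwards [ae_all_iff.mpr hR] with x hx
    funext u
    rw [hx u, restrictTo_dotProduct_eq_observe, Function.comp_apply]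
  have hdirac := ae_of_ae_map (measurable_observe i).aemeasurable
    (condDistrib_comp_self (μ := D.law) (observe i) hmeas)
  rw [← condDistrib_congr hcongr (EventuallyEq.refl _ (observe i))] at hdirac
  filter_upwards [hdirac] with x hx
  rw [hx, Kernel.deterministic_apply]
  simp only [restrictTo_dotProduct_eq_observe]

/-- Under the prior that makes `X` uniform on `±v` coordinatewise, the observations `v` and `-v`
yield the same conditional law of the reference variables, hence the same answer. -/
lemma Elicitable.dotProduct_eq_zero {κ : Type} [Countable κ] {Q : Query n}
    {R : κ → Prior n → Signals n → ℝ} (hQ : Elicitable Q R) {q : Finset (Fin n) → ℝ}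
    {c : κ → Finset (Fin n) → ℝ} (hq : ∀ D, Q.out D =ᵐ[D.law] (q ⬝ᵥ ·))
    (hc : ∀ u D, R u D =ᵐ[D.law] (c u ⬝ᵥ ·)) {v : Finset (Fin n) → ℝ}
    (hv : restrictTo Q.agent v = v) (hcv : ∀ u, c u ⬝ᵥ v = 0) : q ⬝ᵥ v = 0 := by
  rcases eq_or_ne v 0 with rfl | hne
  · exact dotProduct_zero q
  have hvT : ∀ T, Q.agent ∉ T → v T = 0 := fun T hT => by
    rw [← hv, restrictTo_apply, if_neg hT]
  obtain ⟨π, hπ⟩ := hQ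
  set D := symmPrior v (hvT ∅ (Finset.notMem_empty _)) hne
  have hobserved : ∀ᵐ x ∂D.law, restrictTo Q.agent x = x := by
    have hzero : ∀ᵐ x ∂D.law, ∀ T, Q.agent ∉ T → x T = 0 := ae_all_iff.mpr fun T =>
      Filter.eventually_imp_distrib_left.mpr fun hT => ae_symmPrior_eq_zero (hvT T hT)
    filter_upwards [hzero] with x hx
    funext T
    rw [restrictTo_apply]
    split_ifs with hT
    · rfl
    · exact (hx T hT).symm
  have hdirac := D.condDistrib_observe_ae_eq_dirac Q.agent (R := fun u => R u D) (c := c)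
    fun u => by
      filter_upwards [hc u D, hobserved] with x hx hobs
      rw [hx, restrictTo_dotProduct, hobs]
  have hall := (hπ D).and (hdirac.and (hq D))
  obtain ⟨⟨-, hmax⟩, hν, hout⟩ := of_ae_symmPrior hall (x := v) fun T => Or.inl rfl
  obtain ⟨⟨-, hmax'⟩, hν', hout'⟩ := of_ae_symmPrior hall (x := -v) fun T => Or.inr rfl
  simp only [restrictTo_dotProduct, hv, dotProduct_neg, hcv, neg_zero] at hν hν'
  rw [hν] at hmax
  rw [hν'] at hmax'
  have hsame : Q.out D v = Q.out D (-v) := by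
    by_contra hdiff
    exact lt_asymm (hmax _ (Ne.symm hdiff)) (hmax' _ hdiff)
  simp only [hout, hout', dotProduct_neg] at hsame
  exact self_eq_neg.mp hsame

lemma Elicitable.restrictTo_mem_span {κ : Type} [Countable κ] {Q : Query n}
    {R : κ → Prior n → Signals n → ℝ} (hQ : Elicitable Q R) {q : Finset (Fin n) → ℝ}
    {c : κ → Finset (Fin n) → ℝ} (hq : ∀ D, Q.out D =ᵐ[D.law] (q ⬝ᵥ ·))
    (hc : ∀ u D, R u D =ᵐ[D.law] (c u ⬝ᵥ ·)) :
    restrictTo Q.agent q ∈ Submodule.span ℝ (Set.range fun u => restrictTo Q.agent (c u)) := by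
  refine mem_span_of_forall_dotProduct_eq_zero fun v hv => ?_
  rw [restrictTo_dotProduct]
  refine hQ.dotProduct_eq_zero hq hc (restrictTo_restrictTo _ v) fun u => ?_
  rw [← restrictTo_dotProduct]
  exact hv _ ⟨u, rfl⟩

/-- The coefficients of `∑_{T ⊇ S} X_T`; as a function of `T`, the product over `S` of the
indicators of the experts. -/
def upperIndicator (S : Finset (Fin n)) : Finset (Fin n) → ℝ := fun T => if S ⊆ T then 1 else 0

lemma restrictTo_upperIndicator (i : Fin n) (S : Finset (Fin n)) :
    restrictTo i (upperIndicator S) = upperIndicator (insert i S) := by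
  funext T
  simp only [restrictTo_apply, upperIndicator, Finset.insert_subset_iff, ite_and]

lemma upperIndicator_empty : upperIndicator (∅ : Finset (Fin n)) = 1 := by
  funext T
  exact if_pos (Finset.empty_subset T)

lemma restrictTo_mem_span_upperIndicator {i : Fin n} {𝒮 𝒯 : Set (Finset (Fin n))}
    (h : ∀ S ∈ 𝒮, insert i S ∈ 𝒯) {b : Finset (Fin n) → ℝ}
    (hb : b ∈ Submodule.span ℝ (upperIndicator '' 𝒮)) :
    restrictTo i b ∈ Submodule.span ℝ (upperIndicator '' 𝒯) := by
  refine (Submodule.map_span_le (restrictTo i) _ _).mpr ?_ (Submodule.mem_map_of_mem hb)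
  rintro _ ⟨S, hS, rfl⟩
  rw [restrictTo_upperIndicator]
  exact Submodule.subset_span ⟨_, h S hS, rfl⟩

lemma IsNodeCoeff.mem_span {𝒬 : Fin m → Query n} {c : Option (Fin m) → Finset (Fin n) → ℝ}
    (hc : IsNodeCoeff 𝒬 c) {G : Digraph (Option (Fin m))} (hG : DAGElicits 𝒬 G) (j : Fin m) :
    c (some j) ∈ Submodule.span ℝ
      (upperIndicator '' {S | S.Nonempty ∧ (S : Set (Fin n)) ⊆ relevantAgents 𝒬 G j}) := by
  suffices h : ∀ v j, v = some j → c (some j) ∈ Submodule.span ℝ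
      (upperIndicator '' {S | S.Nonempty ∧ (S : Set (Fin n)) ⊆ relevantAgents 𝒬 G j}) from
    h _ j rfl
  intro v
  induction v using (wellFounded_adj hG.1).induction with
  | _ v ih =>
    rintro j rfl
    have hself : (𝒬 j).agent ∈ relevantAgents 𝒬 G j := ⟨j, .refl, rfl⟩
    have hspan := (hG.2.2 j).restrictTo_mem_span (hc.nodeVar_ae_eq (some j))
      fun u => hc.nodeVar_ae_eq u.1
    rw [hc.restrictTo_coeff] at hspan
    refine Submodule.span_le.mpr ?_ hspan
    rintro _ ⟨⟨u, hu⟩, rfl⟩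
    cases u with
    | none =>
      simp only [hc.coeff_none, ← upperIndicator_empty, restrictTo_upperIndicator]
      refine Submodule.subset_span ⟨_, ⟨Finset.insert_nonempty _ _, ?_⟩, rfl⟩
      simpa using hself
    | some k =>
      refine restrictTo_mem_span_upperIndicator ?_ (ih _ hu k rfl)
      rintro S ⟨-, hS⟩
      refine ⟨Finset.insert_nonempty _ _, ?_⟩
      rw [Finset.coe_insert, Set.insert_subset_iff]
      refine ⟨hself, fun i hi => ?_⟩
      obtain ⟨l, hl, hli⟩ := hS hi
      exact ⟨l, .head hu hl, hli⟩

/-- The coefficients of linear forms in the signals that are polynomials of degree at most `d`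
without constant term in the indicators of the experts. -/
def lowDegree (n d : ℕ) : Submodule ℝ (Finset (Fin n) → ℝ) :=
  Submodule.span ℝ (upperIndicator '' {S | S.Nonempty ∧ S.card ≤ d})

lemma exists_dagElicits_of_agentComplexity_le {𝒬 : Fin m → Query n} {d : ℕ}
    (h : agentComplexity 𝒬 ≤ d) :
    ∃ G, DAGElicits 𝒬 G ∧ ∀ j, (relevantAgents 𝒬 G j).encard ≤ d := by
  have hlt : agentComplexity 𝒬 < (d : ℕ∞) + 1 :=
    h.trans_lt (ENat.lt_add_one_iff (ENat.natCast_ne_top d) |>.mpr le_rfl)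
  simp only [agentComplexity, iInf_lt_iff] at hlt
  obtain ⟨G, hG, hG'⟩ := hlt
  exact ⟨G, hG, fun j => Order.le_of_lt_add_one
    ((le_iSup (fun j => (relevantAgents 𝒬 G j).encard) j).trans_lt hG')⟩

theorem AggregationRule.IsLinear.exists_output_ae_eq {R : AggregationRule n} (hR : R.IsLinear)
    {d : ℕ} (hd : agentComplexity R.query ≤ d) :
    ∃ c ∈ lowDegree n d, ∀ D : Prior n, R.output D =ᵐ[D.law] (c ⬝ᵥ ·) := by
  obtain ⟨⟨G, hG, α, hα⟩, β, hβ⟩ := hR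
  obtain ⟨c, hc⟩ := exists_isNodeCoeff hG.1 hα
  obtain ⟨G', hG', hcard⟩ := exists_dagElicits_of_agentComplexity_le hd
  refine ⟨∑ j, β j • c (some j), ?_, fun D => ?_⟩
  · refine Submodule.sum_mem _ fun j _ => Submodule.smul_mem _ _ ?_
    refine Submodule.span_mono (Set.image_mono ?_) (hc.mem_span hG' j)
    rintro S ⟨hS, hSj⟩
    have hle := (Set.encard_le_encard hSj).trans (hcard j)
    rw [Set.encard_coe_eq_coe_finsetCard] at hle
    exact ⟨hS, by exact_mod_cast hle⟩
  · filter_upwards [ae_all_iff.mpr fun j => hc.nodeVar_ae_eq (some j) D] with x hx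
    rw [AggregationRule.output, hβ, sum_dotProduct]
    exact Finset.sum_congr rfl fun j _ => by rw [smul_dotProduct, ← hx j]; rfl

end Structure

/-! ### The lower bound on the error -/

section LowerBound

open Polynomial
open scoped Matrix

lemma sum_abs_le_of_abs_dotProduct_le {ι : Type*} [Fintype ι] {l : ι → ℝ} {C : ℝ} (hC : 0 ≤ C)
    (h : ∀ v : ι → ℝ, |l ⬝ᵥ v| ≤ C * ‖v‖) : ∑ i, |l i| ≤ C := by
  have hsign : ‖fun i => (SignType.sign (l i) : ℝ)‖ ≤ 1 := by
    refine (pi_norm_le_iff_of_nonneg zero_le_one).mpr fun i => ?_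
    rcases SignType.sign (l i) with _ | _ | _ <;> simp
  calc ∑ i, |l i| = l ⬝ᵥ fun i => (SignType.sign (l i) : ℝ) := by
        simp only [dotProduct, self_mul_sign]
    _ ≤ |l ⬝ᵥ fun i => (SignType.sign (l i) : ℝ)| := le_abs_self _
    _ ≤ C * ‖fun i => (SignType.sign (l i) : ℝ)‖ := h _
    _ ≤ C := mul_le_of_le_one_right hC hsign

lemma exists_dotProduct_eq_infDist {ι : Type*} [Fintype ι] (W : Submodule ℝ (ι → ℝ)) (x : ι → ℝ) :
    ∃ l : ι → ℝ, ∑ i, |l i| ≤ 1 ∧ (∀ v ∈ W, l ⬝ᵥ v = 0) ∧ l ⬝ᵥ x = Metric.infDist x W := by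
  classical
  obtain ⟨g, hg, hgx⟩ := exists_dual_vector'' ℝ (W.mkQ x)
  obtain ⟨l, hl⟩ := (dotProductEquiv ℝ ι).surjective (g.toLinearMap ∘ₗ W.mkQ)
  have hdot : ∀ v, l ⬝ᵥ v = g (W.mkQ v) := fun v => by
    rw [← dotProductEquiv_apply_apply, hl]
    rfl
  refine ⟨l, sum_abs_le_of_abs_dotProduct_le zero_le_one fun v => ?_, fun v hv => ?_, ?_⟩
  · rw [hdot]
    exact (g.le_of_opNorm_le hg _).trans
      (mul_le_mul_of_nonneg_left (Submodule.Quotient.norm_mk_le W v) zero_le_one)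
  · rw [hdot, Submodule.mkQ_apply, (Submodule.Quotient.mk_eq_zero W).mpr hv, map_zero]
  · rw [hdot, hgx]
    exact QuotientAddGroup.norm_mk (S := W.toAddSubgroup) x

lemma exists_dual_weights (n d : ℕ) : ∃ l : ℕ → ℝ, l 0 = 0 ∧
    ∑ k ∈ Finset.range (n + 1), |l k| ≤ 1 ∧
    (∀ q : ℝ[X], q.natDegree ≤ d → q.eval 0 = 0 →
      ∑ k ∈ Finset.range (n + 1), l k * q.eval (k : ℝ) = 0) ∧
    ∑ k ∈ Finset.range (n + 1), l k = minDev n d := by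
  obtain ⟨l, hl, horth, hdist⟩ := exists_dotProduct_eq_infDist (devSpace n d) 1
  have hinj : Function.Injective fun k : Fin n => (k : ℕ) + 1 :=
    (add_left_injective 1).comp Fin.val_injective
  let l' : ℕ → ℝ := Function.extend (fun k : Fin n => (k : ℕ) + 1) l 0
  have hl'0 : l' 0 = 0 := Function.extend_apply' _ _ _ fun ⟨k, hk⟩ => Nat.succ_ne_zero _ hk
  have hl' : ∀ k : Fin n, l' (k + 1) = l k := hinj.extend_apply l 0
  have hsum : ∀ F : ℕ → ℝ → ℝ, F 0 0 = 0 → ∑ k ∈ Finset.range (n + 1), F k (l' k) =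
      ∑ k : Fin n, F (k + 1) (l k) := fun F hF => by
    rw [Finset.sum_range_succ', hl'0, hF, add_zero, Finset.sum_range]
    exact Finset.sum_congr rfl fun k _ => by rw [hl']
  refine ⟨l', hl'0, ?_, fun q hq hq0 => ?_, ?_⟩
  · rwa [hsum (fun _ y => |y|) abs_zero]
  · rw [hsum (fun k y => y * q.eval (k : ℝ)) (zero_mul _)]
    exact horth (fun k => q.eval (((k : ℕ) + 1 : ℕ) : ℝ))
      (mem_devSpace.mpr ⟨q, hq, hq0, fun k => by rw [Nat.cast_succ]⟩)
  · rwa [hsum (fun _ y => y) rfl, ← dotProduct_one]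

lemma sum_powersetCard_upperIndicator_mul_choose {n : ℕ} (S : Finset (Fin n)) (k : ℕ) :
    (∑ T ∈ Finset.univ.powersetCard k, upperIndicator S T) * n.choose S.card =
      n.choose k * k.choose S.card := by
  rcases lt_or_ge k S.card with hk | hk
  · rw [Nat.choose_eq_zero_of_lt hk, Nat.cast_zero, mul_zero, Finset.sum_eq_zero, zero_mul]
    intro T hT
    refine if_neg fun hST => ?_
    rw [Finset.mem_powersetCard] at hT
    exact hk.not_ge (hT.2 ▸ Finset.card_le_card hST)
  · have hcard := Finset.card_filter_powersetCard_subset S Finset.univ k (Finset.subset_univ S) hk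
    rw [Finset.card_univ, Fintype.card_fin] at hcard
    simp only [upperIndicator]
    rw [Finset.sum_boole, hcard, mul_comm]
    exact_mod_cast (Nat.choose_mul hk).symm

lemma sum_div_choose_mul_upperIndicator {n : ℕ} (l : ℕ → ℝ) (S : Finset (Fin n)) :
    ∑ T : Finset (Fin n), l T.card / n.choose T.card * upperIndicator S T =
      ∑ k ∈ Finset.range (n + 1), l k * (k.choose S.card / n.choose S.card) := by
  rw [← Finset.powerset_univ, Finset.sum_powerset, Finset.card_univ, Fintype.card_fin]
  refine Finset.sum_congr rfl fun k hk => ?_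
  have hk0 : (n.choose k : ℝ) ≠ 0 := by
    exact_mod_cast (Nat.choose_pos (Finset.mem_range_succ_iff.mp hk)).ne'
  have hS0 : (n.choose S.card : ℝ) ≠ 0 := by
    exact_mod_cast (Nat.choose_pos (card_finset_fin_le S)).ne'
  calc ∑ T ∈ Finset.univ.powersetCard k, l T.card / n.choose T.card * upperIndicator S T
      = ∑ T ∈ Finset.univ.powersetCard k, l k / n.choose k * upperIndicator S T :=
        Finset.sum_congr rfl fun T hT => by rw [(Finset.mem_powersetCard.mp hT).2]
    _ = l k / n.choose k * (n.choose k * k.choose S.card / n.choose S.card) := by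
        rw [← Finset.mul_sum, eq_div_of_mul_eq hS0 (sum_powersetCard_upperIndicator_mul_choose S k)]
    _ = l k * (k.choose S.card / n.choose S.card) := by field_simp

lemma sum_div_choose {n : ℕ} (l : ℕ → ℝ) :
    ∑ T : Finset (Fin n), l T.card / n.choose T.card = ∑ k ∈ Finset.range (n + 1), l k := by
  simpa only [upperIndicator_empty, Pi.one_apply, Finset.card_empty, Nat.choose_zero_right,
    Nat.cast_one, div_one, mul_one] using sum_div_choose_mul_upperIndicator l (∅ : Finset (Fin n))

/-- The weights spread those of `exists_dual_weights` uniformly over the sets of equal size: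
averaging `upperIndicator S` in this way gives a polynomial of degree `#S` in the size. -/
lemma exists_dual_lowDegree (n d : ℕ) : ∃ μ : Finset (Fin n) → ℝ, μ ∅ = 0 ∧ ∑ T, |μ T| ≤ 1 ∧
    (∀ c ∈ lowDegree n d, μ ⬝ᵥ c = 0) ∧ ∑ T, μ T = minDev n d := by
  obtain ⟨l, hl0, hl, horth, hsum⟩ := exists_dual_weights n d
  have hS : ∀ S : Finset (Fin n), S.Nonempty → S.card ≤ d →
      (fun T : Finset (Fin n) => l T.card / n.choose T.card) ⬝ᵥ upperIndicator S = 0 := by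
    intro S hS hSd
    have hdeg := (natDegree_C_mul_le ((S.card.factorial : ℝ)⁻¹ * (n.choose S.card : ℝ)⁻¹)
      (descPochhammer ℝ S.card)).trans ((descPochhammer_natDegree ℝ _).trans_le hSd)
    rw [dotProduct, sum_div_choose_mul_upperIndicator, ← horth _ hdeg
      (by rw [eval_mul, descPochhammer_ne_zero_eval_zero _ hS.card_pos.ne', mul_zero])]
    refine Finset.sum_congr rfl fun k _ => ?_
    rw [eval_mul, eval_C, Nat.cast_choose_eq_descPochhammer_div]
    ring
  refine ⟨fun T => l T.card / n.choose T.card, by simp [hl0], ?_, fun c hc => ?_, ?_⟩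
  · simpa only [abs_div, Nat.abs_cast, sum_div_choose fun k => |l k|] using hl
  · refine (Submodule.span_le (p := LinearMap.ker (dotProductEquiv ℝ _ _))).mpr ?_ hc
    rintro _ ⟨S, ⟨hSne, hSd⟩, rfl⟩
    exact hS S hSne hSd
  · rw [sum_div_choose, hsum]

lemma sq_sum_le_sum_sub_one_sq_mul_abs {ι : Type*} [Fintype ι] {μ c : ι → ℝ}
    (hμ : ∑ i, |μ i| ≤ 1) (hc : μ ⬝ᵥ c = 0) : (∑ i, μ i) ^ 2 ≤ ∑ i, (c i - 1) ^ 2 * |μ i| := by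
  have hnonneg : ∀ i, 0 ≤ (c i - 1) ^ 2 * |μ i| := fun i => by positivity
  calc (∑ i, μ i) ^ 2 = (∑ i, μ i * (c i - 1)) ^ 2 := by
        simp only [mul_sub, mul_one, Finset.sum_sub_distrib]
        rw [← dotProduct, hc, zero_sub, neg_sq]
    _ ≤ (∑ i, |μ i|) * ∑ i, (c i - 1) ^ 2 * |μ i| :=
        Finset.sum_sq_le_sum_mul_sum_of_sq_le_mul _ (fun i _ => abs_nonneg _)
          (fun i _ => hnonneg i) fun i _ => by
            rw [mul_pow, mul_left_comm, ← sq, sq_abs, mul_comm]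
    _ ≤ ∑ i, (c i - 1) ^ 2 * |μ i| :=
        mul_le_of_le_one_left (Finset.sum_nonneg fun i _ => hnonneg i) hμ

variable {n d : ℕ} {Z : RandomContext} {A : Approximator n Z}

lemma RandomizedRule.Implements.le_loss {R : RandomizedRule n Z} (hR : R.Implements A)
    {D : Prior n} {b : ℝ≥0∞} (hb : ∀ᵐ z ∂Z.P,
      b ≤ ∫⁻ x, ENNReal.ofReal (((R.rule z).output D x - target x) ^ 2) ∂D.law) :
    b ≤ loss A D := by
  have hmeas : Measurable fun p : Z.Ω × Signals n =>
      ENNReal.ofReal (((R.rule p.1).output D p.2 - target p.2) ^ 2) :=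
    (((R.measurable_output D).sub
      (measurable_target.comp measurable_snd)).pow_const 2).ennreal_ofReal
  calc b = ∫⁻ _, b ∂Z.P := by rw [lintegral_const, measure_univ, mul_one]
    _ ≤ ∫⁻ z, ∫⁻ x, ENNReal.ofReal (((R.rule z).output D x - target x) ^ 2) ∂D.law ∂Z.P :=
        lintegral_mono_ae hb
    _ = ∫⁻ p, ENNReal.ofReal (((R.rule p.1).output D p.2 - target p.2) ^ 2) ∂Z.P.prod D.law :=
        (lintegral_prod _ hmeas.aemeasurable).symm
    _ = loss A D := lintegral_congr_ae <| by filter_upwards [hR D] with p hp using by rw [hp]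

theorem minDev_sq_le_worstError (hA : A ∈ linApproximators n d Z) :
    ENNReal.ofReal (minDev n d ^ 2) ≤ worstError A := by
  obtain ⟨R, hRA, hR⟩ := hA
  obtain ⟨μ, hμempty, hμ, horth, hsum⟩ := exists_dual_lowDegree n d
  rcases eq_or_ne (minDev n d) 0 with hM | hM
  · simp [hM]
  obtain ⟨T₀, -, hT₀⟩ : ∃ T ∈ Finset.univ, μ T ≠ 0 :=
    Finset.exists_ne_zero_of_sum_ne_zero (hsum ▸ hM)
  set D := symmPrior (fun T => √|μ T|) (by simp [hμempty])
    (Function.ne_iff.mpr ⟨T₀, Real.sqrt_ne_zero'.mpr (abs_pos.mpr hT₀)⟩) with hD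
  have hvar : ∀ T, variance (fun x : ℝ => x) (D.dist T) = |μ T| := fun T => by
    rw [hD, variance_symmPrior, Real.sq_sqrt (abs_nonneg _)]
  have hloss : ENNReal.ofReal (minDev n d ^ 2) ≤ loss A D := hRA.le_loss <| by
    filter_upwards [hR] with z ⟨hlin, hagent, _⟩
    obtain ⟨c, hc, hout⟩ := hlin.exists_output_ae_eq hagent
    rw [D.lintegral_sub_target_sq (hout D), ← hsum]
    simp only [hvar]
    exact ENNReal.ofReal_le_ofReal (sq_sum_le_sum_sub_one_sq_mul_abs hμ (horth c hc))
  refine le_trans ?_ (le_iSup _ D)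
  have hpos : 0 < ∑ T, |μ T| :=
    Finset.sum_pos' (fun _ _ => abs_nonneg _) ⟨T₀, Finset.mem_univ _, abs_pos.mpr hT₀⟩
  simp only [hvar]
  rw [ENNReal.le_div_iff_mul_le (Or.inl (by simpa using hpos)) (Or.inl ENNReal.ofReal_ne_top)]
  exact (mul_le_of_le_one_right' (ENNReal.ofReal_le_one.mpr hμ)).trans hloss

end LowerBound

/-! ### The upper bound on the error -/

section Elicitation

open scoped Matrix

variable {n : ℕ}

/-- The query put to expert `i` whose answer is the observed part of the linear form `b`. -/
def linQuery (i : Fin n) (b : Finset (Fin n) → ℝ) : Query n where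
  agent := i
  answer _ s := (fun T : {T : Finset (Fin n) // i ∈ T} => b T) ⬝ᵥ s
  measurable_answer _ := measurable_dotProduct _

lemma linQuery_out (i : Fin n) (b : Finset (Fin n) → ℝ) (D : Prior n) :
    (linQuery i b).out D = (restrictTo i b ⬝ᵥ ·) :=
  funext fun x => (restrictTo_dotProduct_eq_observe i b x).symm

lemma integrable_neg_sub_sq {Ω : Type*} [MeasurableSpace Ω] {ν : Measure Ω} [IsFiniteMeasure ν]
    {f : Ω → ℝ} (hf : MemLp f 2 ν) (r : ℝ) : Integrable (fun ω => -(r - f ω) ^ 2) ν :=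
  ((memLp_const r).sub hf).integrable_sq.neg

lemma integral_neg_sub_sq_lt {Ω : Type*} [MeasurableSpace Ω] {ν : Measure Ω}
    [IsProbabilityMeasure ν] {f : Ω → ℝ} (hf : MemLp f 2 ν) {r : ℝ} (hr : r ≠ ∫ ω, f ω ∂ν) :
    ∫ ω, -(r - f ω) ^ 2 ∂ν < ∫ ω, -((∫ ω, f ω ∂ν) - f ω) ^ 2 ∂ν := by
  have hfint : Integrable f ν := hf.integrable one_le_two
  have hexpand : ∀ a : ℝ, ∫ ω, -(a - f ω) ^ 2 ∂ν =
      -a ^ 2 + 2 * a * (∫ ω, f ω ∂ν) - ∫ ω, f ω ^ 2 ∂ν := by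
    intro a
    have hlin : Integrable (fun ω => -a ^ 2 + 2 * a * f ω) ν :=
      (integrable_const _).add (hfint.const_mul _)
    calc ∫ ω, -(a - f ω) ^ 2 ∂ν = ∫ ω, (-a ^ 2 + 2 * a * f ω) - f ω ^ 2 ∂ν := by
          congr 1 with ω
          ring
      _ = _ := by
          rw [integral_sub hlin hf.integrable_sq, integral_add (integrable_const _)
            (hfint.const_mul _), integral_const_mul, integral_const, probReal_univ, one_smul]
  rw [hexpand, hexpand]
  linarith [sq_pos_of_ne_zero (sub_ne_zero.mpr hr)]

lemma memLp_condDistrib_ae {α β Ω E : Type*} [MeasurableSpace α] [MeasurableSpace β]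
    [MeasurableSpace Ω] [StandardBorelSpace Ω] [Nonempty Ω] [NormedAddCommGroup E]
    {μ : Measure α} [IsFiniteMeasure μ] {X : α → β} {Y : α → Ω} {f : Ω → E}
    (hX : AEMeasurable X μ) (hY : AEMeasurable Y μ) (hf : StronglyMeasurable f)
    (hfY : MemLp (f ∘ Y) 2 μ) : ∀ᵐ a ∂μ, MemLp f 2 (condDistrib Y X μ (X a)) := by
  have hsq := (memLp_two_iff_integrable_sq_norm
    (hf.aestronglyMeasurable.comp_aemeasurable hY)).mp hfY
  have hpair : Integrable (fun p : β × Ω => ‖f p.2‖ ^ 2) (μ.map fun a => (X a, Y a)) :=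
    (integrable_map_measure ((hf.comp_measurable measurable_snd).norm.pow 2).aestronglyMeasurable
      (hX.prodMk hY)).mpr hsq
  filter_upwards [hpair.condDistrib_ae hX hY] with a ha
  exact (memLp_two_iff_integrable_sq_norm hf.aestronglyMeasurable).mpr ha

lemma elicitable_of_out_ae_eq_condExp {κ : Type} [Countable κ] {Q : Query n}
    {R : κ → Prior n → Signals n → ℝ} (hR : ∀ v D, Measurable (R v D)) (w : κ)
    (hL2 : ∀ D : Prior n, MemLp (R w D) 2 D.law)
    (hQ : ∀ D : Prior n, Q.out D =ᵐ[D.law] (D.law)[R w D | agentSigma Q.agent]) :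
    Elicitable Q R := by
  refine ⟨fun r z => -(r - z w) ^ 2, fun D => ?_⟩
  have hobs : Measurable (observe Q.agent) := measurable_observe Q.agent
  have hY : AEMeasurable (fun y v => R v D y) D.law :=
    (measurable_pi_lambda _ fun v => hR v D).aemeasurable
  have hcoord : StronglyMeasurable fun z : κ → ℝ => z w :=
    (measurable_pi_apply w).stronglyMeasurable
  have hcondExp := condExp_ae_eq_integral_condDistrib hobs hY hcoord
    ((hL2 D).integrable one_le_two)
  filter_upwards [(hQ D).trans hcondExp, memLp_condDistrib_ae hobs.aemeasurable hY hcoord (hL2 D)]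
    with x hout hmem
  refine ⟨integrable_neg_sub_sq hmem, fun r hr => ?_⟩
  rw [hout] at hr ⊢
  exact integral_neg_sub_sq_lt hmem hr

end Elicitation

section NestedForecasts

open scoped Matrix

variable {n d : ℕ}

/-- The nonempty sets of at most `d` experts. -/
abbrev SmallSet (n d : ℕ) : Type := {S : Finset (Fin n) // S.Nonempty ∧ S.card ≤ d}

/-- The positions of the nested forecasts in their query list, one for each small set. -/
abbrev NestedIndex (n d : ℕ) : Type := Fin (Fintype.card (SmallSet n d))

/-- The set of experts of a node of the graph of nested forecasts; it is empty at `Y`. -/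
noncomputable def nodeSet (n d : ℕ) : Option (NestedIndex n d) → Finset (Fin n)
  | some j => ((Fintype.equivFin (SmallSet n d)).symm j).1
  | none => ∅

lemma nodeSet_some_nonempty (j : NestedIndex n d) : (nodeSet n d (some j)).Nonempty :=
  ((Fintype.equivFin (SmallSet n d)).symm j).2.1

lemma nodeSet_injective (n d : ℕ) : Function.Injective (nodeSet n d) := by
  rintro (_ | j) (_ | k) h
  · rfl
  · exact absurd h.symm (nodeSet_some_nonempty k).ne_empty
  · exact absurd h (nodeSet_some_nonempty j).ne_empty
  · exact congrArg some ((Fintype.equivFin (SmallSet n d)).symm.injective (Subtype.ext h))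

lemma card_nodeSet_le (v : Option (NestedIndex n d)) : (nodeSet n d v).card ≤ d := by
  cases v with
  | none => exact Nat.zero_le _
  | some j => exact ((Fintype.equivFin (SmallSet n d)).symm j).2.2

lemma exists_nodeSet_eq {S : Finset (Fin n)} (hS : S.card ≤ d) : ∃ v, nodeSet n d v = S := by
  rcases S.eq_empty_or_nonempty with rfl | hne
  · exact ⟨none, rfl⟩
  · exact ⟨some (Fintype.equivFin (SmallSet n d) ⟨S, hne, hS⟩), by simp [nodeSet]⟩

lemma sum_nodeSet {M : Type*} [AddCommMonoid M] (n d : ℕ) (F : Finset (Fin n) → M) :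
    ∑ j, F (nodeSet n d (some j)) = ∑ S with S.Nonempty ∧ S.card ≤ d, F S := by
  rw [Finset.sum_subtype (F := inferInstanceAs (Fintype (SmallSet n d)))
    (p := fun S => S.Nonempty ∧ S.card ≤ d) _ (by simp) F]
  exact (Fintype.equivFin (SmallSet n d)).symm.sum_comp fun S => F S.1

/-- The expert of the set `nodeSet n d (some j)` who forecasts the nested forecast of the others.
Any choice of an expert in the set would do. -/
noncomputable def nestedAgent (j : NestedIndex n d) : Fin n :=
  (nodeSet n d (some j)).min' (nodeSet_some_nonempty j)

lemma nestedAgent_mem (j : NestedIndex n d) : nestedAgent j ∈ nodeSet n d (some j) :=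
  Finset.min'_mem _ _

/-- The nested forecasts `𝔼[𝔼[⋯ 𝔼[Y | S_k] ⋯ | S_j] | S_i]`, one for each small set of experts. -/
noncomputable def nestedQuery (n d : ℕ) (j : NestedIndex n d) : Query n :=
  linQuery (nestedAgent j) (upperIndicator ((nodeSet n d (some j)).erase (nestedAgent j)))

lemma nodeVar_nestedQuery (v : Option (NestedIndex n d)) (D : Prior n) :
    nodeVar (nestedQuery n d) v D = (upperIndicator (nodeSet n d v) ⬝ᵥ ·) := by
  cases v with
  | none => rw [nodeVar, target_eq_one_dotProduct, nodeSet, upperIndicator_empty]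
  | some j =>
    rw [nodeVar, nestedQuery, linQuery_out, restrictTo_upperIndicator,
      Finset.insert_erase (nestedAgent_mem j)]

/-- The graph of the nested forecasts: each forecast points to the one that it is a forecast of. -/
noncomputable def nestedGraph (n d : ℕ) : Digraph (Option (NestedIndex n d)) where
  Adj v w := ∃ j, v = some j ∧ nodeSet n d w = (nodeSet n d v).erase (nestedAgent j)

lemma nestedGraph_adj_some {j : NestedIndex n d} {w : Option (NestedIndex n d)} :
    (nestedGraph n d).Adj (some j) w ↔
      nodeSet n d w = (nodeSet n d (some j)).erase (nestedAgent j) := by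
  simp only [nestedGraph, Option.some.injEq, exists_eq_left']

lemma not_nestedGraph_adj_none (w : Option (NestedIndex n d)) : ¬ (nestedGraph n d).Adj none w := by
  simp only [nestedGraph, reduceCtorEq, false_and, exists_false, not_false_eq_true]

lemma existsUnique_nestedGraph_adj (j : NestedIndex n d) :
    ∃! w, (nestedGraph n d).Adj (some j) w := by
  obtain ⟨w, hw⟩ := exists_nodeSet_eq (d := d) (S := (nodeSet n d (some j)).erase (nestedAgent j))
    (Finset.card_erase_le.trans (card_nodeSet_le _))
  refine ⟨w, nestedGraph_adj_some.mpr hw, fun w' hw' => nodeSet_injective n d ?_⟩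
  rw [nestedGraph_adj_some.mp hw', hw]

lemma nestedQuery_out_ae_eq_condExp {j : NestedIndex n d} {w : Option (NestedIndex n d)}
    (h : (nestedGraph n d).Adj (some j) w) (D : Prior n) : (nestedQuery n d j).out D =ᵐ[D.law]
      (D.law)[nodeVar (nestedQuery n d) w D | agentSigma (nestedAgent j)] := by
  rw [nodeVar_nestedQuery, nestedGraph_adj_some.mp h, nestedQuery, linQuery_out]
  exact (D.condExp_dotProduct _ _).symm

variable {v w : Option (NestedIndex n d)}

lemma card_nodeSet_of_adj (h : (nestedGraph n d).Adj v w) :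
    (nodeSet n d w).card + 1 = (nodeSet n d v).card := by
  obtain ⟨j, rfl, h⟩ := h
  rw [h, Finset.card_erase_add_one (nestedAgent_mem j)]

lemma nodeSet_subset_of_adj (h : (nestedGraph n d).Adj v w) : nodeSet n d w ⊆ nodeSet n d v := by
  obtain ⟨j, rfl, h⟩ := h
  exact h ▸ Finset.erase_subset _ _

lemma card_nodeSet_lt_of_transGen (h : Relation.TransGen (nestedGraph n d).Adj v w) :
    (nodeSet n d w).card < (nodeSet n d v).card := by
  induction h with
  | single h => have := card_nodeSet_of_adj h; omega
  | tail _ h ih => have := card_nodeSet_of_adj h; omega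

lemma nodeSet_subset_of_reflTransGen (h : Relation.ReflTransGen (nestedGraph n d).Adj v w) :
    nodeSet n d w ⊆ nodeSet n d v := by
  induction h with
  | refl => exact subset_rfl
  | tail _ h ih => exact (nodeSet_subset_of_adj h).trans ih

lemma dagElicits_nested (n d : ℕ) : DAGElicits (nestedQuery n d) (nestedGraph n d) := by
  refine ⟨fun v hv => (card_nodeSet_lt_of_transGen hv).false, fun v => ⟨fun hsink => ?_, ?_⟩,
    fun j => ?_⟩
  · cases v with
    | none => rfl
    | some j => exact absurd (existsUnique_nestedGraph_adj j).exists (not_exists.mpr hsink)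
  · rintro rfl
    exact not_nestedGraph_adj_none
  · obtain ⟨w, hw⟩ := (existsUnique_nestedGraph_adj j).exists
    refine elicitable_of_out_ae_eq_condExp (fun v D => ?_) ⟨w, hw⟩ (fun D => ?_)
      (nestedQuery_out_ae_eq_condExp hw)
    · rw [nodeVar_nestedQuery]
      exact measurable_dotProduct _
    · rw [nodeVar_nestedQuery]
      exact D.memLp_dotProduct _

lemma agentComplexity_nestedQuery_le (n d : ℕ) : agentComplexity (nestedQuery n d) ≤ d := by
  refine iInf₂_le_of_le (nestedGraph n d) (dagElicits_nested n d) (iSup_le fun j => ?_)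
  calc (relevantAgents (nestedQuery n d) (nestedGraph n d) j).encard
      ≤ (nodeSet n d (some j) : Set (Fin n)).encard := by
        refine Set.encard_le_encard ?_
        rintro i ⟨k, hk, rfl⟩
        exact nodeSet_subset_of_reflTransGen hk (nestedAgent_mem k)
    _ ≤ d := by
        rw [Set.encard_coe_eq_coe_finsetCard]
        exact_mod_cast card_nodeSet_le (some j)

lemma orderComplexity_nestedQuery_le (n d : ℕ) : orderComplexity (nestedQuery n d) ≤ d := by
  refine iInf₂_le_of_le (nestedGraph n d) (dagElicits_nested n d) (iSup_le fun j => sSup_le ?_)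
  rintro _ ⟨l, w, rfl, -, -, hadj⟩
  have hcard : ∀ i ≤ l, (nodeSet n d (w i)).card + i = (nodeSet n d (w 0)).card := by
    intro i hi
    induction i with
    | zero => rfl
    | succ i ih =>
      have := card_nodeSet_of_adj (hadj i hi)
      have := ih (Nat.le_of_succ_le hi)
      omega
  have := hcard l le_rfl
  have := card_nodeSet_le (w 0)
  exact_mod_cast (by omega : l ≤ d)

/-- The aggregation rule that sums up the nested forecasts, weighted by the number of experts. -/
noncomputable def nestedRule (n d : ℕ) (b : ℕ → ℝ) : AggregationRule n where
  size := Fintype.card (SmallSet n d)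
  query := nestedQuery n d
  aggregate y := ∑ j, b (nodeSet n d (some j)).card * y j

lemma isLinear_nestedRule (n d : ℕ) (b : ℕ → ℝ) : (nestedRule n d b).IsLinear := by
  classical
  refine ⟨⟨nestedGraph n d, dagElicits_nested n d, fun _ _ => 1, fun j D => ?_⟩, _, fun _ => rfl⟩
  obtain ⟨w, hw, huniq⟩ := existsUnique_nestedGraph_adj (n := n) (d := d) j
  have hneighbours : Finset.univ.filter ((nestedGraph n d).Adj (some j)) = {w} :=
    Finset.eq_singleton_iff_unique_mem.mpr ⟨by simpa using hw, by simpa using huniq⟩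
  have hsum : (fun x => ∑ v with (nestedGraph n d).Adj (some j) v,
      1 * nodeVar (nestedQuery n d) v D x) = nodeVar (nestedQuery n d) w D := by
    funext x
    rw [hneighbours, Finset.sum_singleton, one_mul]
  exact hsum ▸ nestedQuery_out_ae_eq_condExp hw D

lemma nestedRule_output (n d : ℕ) (b : ℕ → ℝ) (D : Prior n) :
    (nestedRule n d b).output D =
      ((∑ S with S.Nonempty ∧ S.card ≤ d, b S.card • upperIndicator S) ⬝ᵥ ·) := by
  funext x
  rw [← sum_nodeSet n d fun S => b S.card • upperIndicator S, sum_dotProduct]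
  change ∑ j, _ * (nestedQuery n d j).out D x = _
  refine Finset.sum_congr rfl fun j _ => ?_
  rw [smul_dotProduct, smul_eq_mul]
  exact congrArg _ (congrFun (nodeVar_nestedQuery (some j) D) x)

open Polynomial in
lemma sum_fwdDiff_smul_upperIndicator {q : ℝ[X]} (hq : q.natDegree ≤ d) (h0 : q.eval 0 = 0) :
    ∑ S : Finset (Fin n) with S.Nonempty ∧ S.card ≤ d,
      (fwdDiff (1 : ℝ))^[S.card] q.eval 0 • upperIndicator S = fun T => q.eval (T.card : ℝ) := by
  have hvanish : ∀ S : Finset (Fin n), ¬ (S.Nonempty ∧ S.card ≤ d) →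
      (fwdDiff (1 : ℝ))^[S.card] q.eval 0 = 0 := by
    intro S hS
    rcases S.eq_empty_or_nonempty with rfl | hne
    · exact h0
    · have hdeg : q.natDegree < S.card := hq.trans_lt (not_le.mp fun hle => hS ⟨hne, hle⟩)
      rw [fwdDiff_iter_eq_zero_of_degree_lt hdeg, Pi.zero_apply]
  funext T
  calc _ = ∑ S with S.Nonempty ∧ S.card ≤ d,
          (fwdDiff (1 : ℝ))^[S.card] q.eval 0 * upperIndicator S T := by
        simp only [Finset.sum_apply, Pi.smul_apply, smul_eq_mul]
    _ = ∑ S, (fwdDiff (1 : ℝ))^[S.card] q.eval 0 * upperIndicator S T :=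
        Finset.sum_subset (Finset.subset_univ _) fun S _ hS => by
          rw [hvanish S (by simpa using hS), zero_mul]
    _ = ∑ S ∈ T.powerset, (fwdDiff (1 : ℝ))^[S.card] q.eval 0 := by
        simp only [upperIndicator, mul_ite, mul_one, mul_zero, ← Finset.sum_filter]
        congr 1
        ext S
        simp
    _ = q.eval (T.card : ℝ) := by
        rw [Finset.sum_powerset_apply_card fun k => (fwdDiff (1 : ℝ))^[k] q.eval 0,
          ← shift_eq_sum_fwdDiff_iter, zero_add, nsmul_one]

end NestedForecasts

section UpperBound

open Polynomial
open scoped Matrix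

variable {n d : ℕ} {Z : RandomContext}

/-- The random context of a deterministic choice. -/
noncomputable def trivialContext : RandomContext where
  Ω := Unit
  P := Measure.dirac ()

/-- A deterministic aggregation rule as a randomized one. -/
noncomputable def AggregationRule.toRandomized (R : AggregationRule n)
    (hR : ∀ D, Measurable (R.output D)) : RandomizedRule n trivialContext where
  rule _ := R
  measurable_output D := (hR D).comp measurable_snd

lemma loss_comp_snd {f : Prior n → Signals n → ℝ} {D : Prior n} (hf : Measurable (f D)) :
    loss (Z := Z) (fun D p => f D p.2) D =
      ∫⁻ x, ENNReal.ofReal ((f D x - target x) ^ 2) ∂D.law :=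
  measurePreserving_snd.lintegral_comp ((hf.sub measurable_target).pow_const 2).ennreal_ofReal

lemma worstError_le_of_loss_eq {A : Approximator n Z} {c : Finset (Fin n) → ℝ} {M : ℝ}
    (hA : ∀ D : Prior n, loss A D =
      ENNReal.ofReal (∑ T, (c T - 1) ^ 2 * variance (fun x : ℝ => x) (D.dist T)))
    (hc : ∀ T : Finset (Fin n), T.Nonempty → |c T - 1| ≤ M) :
    worstError A ≤ ENNReal.ofReal (M ^ 2) := by
  refine iSup_le fun D => ENNReal.div_le_of_le_mul ?_
  rw [hA, ← ENNReal.ofReal_mul (sq_nonneg M), Finset.mul_sum]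
  refine ENNReal.ofReal_le_ofReal (Finset.sum_le_sum fun T _ => ?_)
  rcases T.eq_empty_or_nonempty with rfl | hT
  · rw [D.dist_empty, variance_dirac, mul_zero, mul_zero]
  · have := variance_nonneg (fun x : ℝ => x) (D.dist T)
    rw [← sq_abs (c T - 1)]
    gcongr
    exact hc T hT

theorem exists_worstError_le (n d : ℕ) : ∃ (Z : RandomContext) (A : Approximator n Z),
    A ∈ linApproximators n d Z ∧ worstError A ≤ ENNReal.ofReal (minDev n d ^ 2) := by
  obtain ⟨p, hp⟩ := exists_isExtremal n d
  have hdeg : (1 - p).natDegree ≤ d :=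
    (natDegree_sub_le _ _).trans (by simpa using hp.natDegree_le)
  let R := nestedRule n d fun k => (fwdDiff (1 : ℝ))^[k] (1 - p).eval 0
  have hout : ∀ D, R.output D = ((fun T => (1 - p).eval (T.card : ℝ)) ⬝ᵥ ·) := fun D => by
    rw [nestedRule_output, sum_fwdDiff_smul_upperIndicator hdeg (by simp [hp.eval_zero])]
  have hmeas : ∀ D, Measurable (R.output D) := fun D => hout D ▸ measurable_dotProduct _
  refine ⟨trivialContext, fun D p => R.output D p.2, ⟨R.toRandomized hmeas,
    fun D => Eventually.of_forall fun _ => rfl, Eventually.of_forall fun _ =>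
      ⟨isLinear_nestedRule n d _, agentComplexity_nestedQuery_le n d,
        orderComplexity_nestedQuery_le n d⟩⟩,
    worstError_le_of_loss_eq (c := fun T => (1 - p).eval (T.card : ℝ)) (fun D => ?_) fun T hT => ?_⟩
  · rw [loss_comp_snd (hmeas D), D.lintegral_sub_target_sq (Eventually.of_forall
      fun x => congrFun (hout D) x)]
  · simpa using hp.abs_eval_le T.card hT.card_pos (by simpa using T.card_le_univ)

theorem optimalError_eq (n d : ℕ) : optimalError n d = ENNReal.ofReal (minDev n d ^ 2) := by
  obtain ⟨Z, A, hA, hle⟩ := exists_worstError_le n d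
  exact le_antisymm (iInf_le_of_le Z (iInf₂_le_of_le A hA hle))
    (le_iInf fun Z => le_iInf₂ fun A hA => minDev_sq_le_worstError hA)

end UpperBound

theorem mainTheorem1 :
    -- the best worst-case error is a minimum, and it is finite
    (∀ n d : ℕ, optimalError n d ≠ ∞ ∧
      ∃ (Z : RandomContext) (A : Approximator n Z),
        A ∈ linApproximators n d Z ∧ worstError A = optimalError n d) ∧
    -- d = o(√n)
    (∀ d : ℕ → ℕ, (fun n : ℕ => (d n : ℝ)) =o[atTop] (fun n : ℕ => √(n : ℝ)) →
      (fun n : ℕ => 1 - (optimalError n (d n)).toReal) =Θ[atTop]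
        (fun n : ℕ => (d n : ℝ) ^ 2 / (n : ℝ))) ∧
    -- d = Θ(√n)
    (∀ d : ℕ → ℕ, (fun n : ℕ => (d n : ℝ)) =Θ[atTop] (fun n : ℕ => √(n : ℝ)) →
      ∃ a b : ℝ, 0 < a ∧ b < 1 ∧
        ∀ᶠ n : ℕ in atTop, (optimalError n (d n)).toReal ∈ Set.Icc a b) ∧
    (∀ (d : ℕ → ℕ) (c : ℝ), 0 < c →
      Tendsto (fun n : ℕ => (d n : ℝ) / √(n : ℝ)) atTop (𝓝 c) →
      ∃ l ∈ Set.Ioo (0 : ℝ) 1,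
        Tendsto (fun n : ℕ => (optimalError n (d n)).toReal) atTop (𝓝 l)) ∧
    -- d = ω(√n)
    (∀ d : ℕ → ℕ, (fun n : ℕ => √(n : ℝ)) =o[atTop] (fun n : ℕ => (d n : ℝ)) →
      (fun n : ℕ => (optimalError n (d n)).toReal) =O[atTop]
        (fun n : ℕ => Real.exp (-4 * (d n : ℝ) / √(n : ℝ)))) := by
  have hval : ∀ n d, (optimalError n d).toReal = minDev n d ^ 2 := fun n d => by
    rw [optimalError_eq, ENNReal.toReal_ofReal (sq_nonneg _)]
  simp only [hval]
  refine ⟨fun n d => ⟨by rw [optimalError_eq]; exact ENNReal.ofReal_ne_top, ?_⟩,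
    fun d => isTheta_one_sub_minDev_sq, fun d => minDev_sq_mem_Icc_of_isTheta,
    fun d c => exists_tendsto_minDev_sq, fun d _ => isBigO_minDev_sq d⟩
  obtain ⟨Z, A, hA, hle⟩ := exists_worstError_le n d
  refine ⟨Z, A, hA, le_antisymm (hle.trans_eq (optimalError_eq n d).symm) ?_⟩
  exact iInf_le_of_le Z (iInf₂_le_of_le A hA le_rfl)
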